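/- Let $\Omega\subset\mathbb R^m$ be an open set. Let $A$ be a measurable field of symmetric $m\times m$ matrices on $\Omega$ with $\mu_1\,\xi\cdot\xi\le A(x)\xi\cdot\xi\le\mu_2\,\xi\cdot\xi$ for all $x\in\Omega$, $\xi\in\mathbb R^m$, where $0<\mu_1,\mu_2$ are constants. Let $\sigma\ge0$ be a constant, $f\in L_2(\Omega)$ and $\psi_D\in H^1(\Omega)$. Let $H^1_0(\Omega)$ be the closure of $C_c^\infty(\Omega)$ in $H^1(\Omega)$, and let $u$ be a weak solution of $$-\operatorname{div}(A\nabla u)+\sigma u=f\ \text{ in }\Omega,\qquad u=\psi_D\ \text{ on }\partial\Omega,$$ that is, $u\in H^1(\Omega)$, $u-\psi_D\in H^1_0(\Omega)$ and $\int_\Omega (A\nabla u\cdot\nabla w+\sigma uw)\,dx=\int_\Omega fw\,dx$ for all $w\in H^1_0(\Omega)$. Write $\|\cdot\|_0$ for the norm of $L_2(\Omega)$, $\|w\|_A^2=\int_\Omega\nabla w\cdot A\nabla w\,dx$, $|||w|||^2=\|w\|_A^2+\sigma\|w\|_0^2$ and $\|y\|_{A^{-1}}^2=\int_\Omega A^{-1}y\cdot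 y\,dx$. Let $\sigma_*>0$, put $\kappa=\sigma/\sigma_*$, and for $g\in L_2(\Omega)$, $v\in H^1(\Omega)$ and $z\in H(\Omega,\operatorname{div})$ put $$\mathcal M(g,v,z)=\|A\nabla v+z\|_{A^{-1}}^2+\theta\,\|g-\sigma v-\operatorname{div}z\|_0^2,$$ where $$\Theta=\frac{2}{1+\kappa},\quad \theta=\frac1{\sigma_*}\quad\text{if }\sigma\le\sigma_*;\qquad \Theta=1,\quad \theta=\frac1\sigma\quad\text{if }\sigma>\sigma_*.$$ **(a)** Let $v\in H^1(\Omega)$ with $v-\psi_D\in H^1_0(\Omega)$ satisfy $\|u-v\|_A^2\ge\sigma_*\|u-v\|_0^2$, and let $z\in H(\Omega,\operatorname{div})$. Then $$|||v-u|||^2\le\Theta\,\mathcal M(f,v,z).$$ **(b)** Let $v$ and $z$ be as in (a). Let $\tau_1,\dots,\tau_R$ be pairwise disjoint bounded convex open sets with $\Omega=\operatorname{interior}\bigcup_r\overline{\tau_r}$, let $h_r=\operatorname{diam}\tau_r$, let $\Pi_r^1$ be the orthogonal projection in $L_2(\tau_r)$ onto the polynomials of degree at most $1$, and let $\hat f=\Pi_r^1f$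 on $\tau_r$ for each $r$. If $\sigma\le\sigma_*$, then for every $\varepsilon>0$ $$|||v-u|||^2\le\Theta_1\Big[\mathcal M(\hat f,v,z)+\sum_r\frac{h_r^2}{\varepsilon\mu_1\pi^2}\int_{\tau_r}(f-\Pi_r^1f)^2dx\Big],$$ where $\Theta_1=\frac{2+\varepsilon}{1+\kappa}$ if $\sigma\le\frac{\sigma_*}{1+\varepsilon}$ and $\Theta_1=1+\varepsilon$ if $\frac{\sigma_*}{1+\varepsilon}\le\sigma\le\sigma_*$. If $\sigma\ge\sigma_*$, then $$|||v-u|||^2\le\Theta_2\Big[\mathcal M(\hat f,v,z)+\sum_r\frac1\sigma\int_{\tau_r}(f-\Pi_r^1f)^2dx\Big],\qquad \Theta_2=1+\frac1{1+\kappa^{-1}}.$$ **(c)** Let $u\in H^1_0(\Omega)$ (homogeneous boundary condition). Let $V\subset H^1_0(\Omega)$ be a linear subspace for which the $L_2(\Omega)$-orthogonal projection $Q$ onto $V$ exists (for example, a finite-dimensional one), and let $u_G\in V$ be the Galerkin solution: $\int_\Omega(A\nabla u_G\cdot\nabla w+\sigma u_Gw)\,dx=\int_\Omega fw\,dx$ for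 all $w\in V$. Suppose that $z_G:=-A\nabla u_G\in H(\Omega,\operatorname{div})$ and $\|u-u_G\|_A^2\ge\sigma_*\|u-Qu\|_0^2$. Then $$|||u_G-u|||^2\le\Theta\,\theta\,\|f-\sigma u_G-\operatorname{div}z_G\|_0^2.$$ -/

import Mathlib

open MeasureTheory
open scoped Matrix ContDiff

noncomputable section

namespace ReactionDiffusion

/-- The Euclidean space `ℝᵐ`. -/
abbrev Space (m : ℕ) : Type := EuclideanSpace ℝ (Fin m)

/-- `L₂(Ω)`. -/
abbrev L2 {m : ℕ} (Ω : Set (Space m)) : Type := Lp ℝ 2 (volume.restrict Ω)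

/-- `L₂(Ω)ᵐ`. -/
abbrev L2Vec {m : ℕ} (Ω : Set (Space m)) : Type := Lp (Space m) 2 (volume.restrict Ω)

/-- The test functions `C_c^∞(Ω)`. -/
def IsTest {m : ℕ} (Ω : Set (Space m)) (φ : Space m → ℝ) : Prop :=
  ContDiff ℝ ∞ φ ∧ HasCompactSupport φ ∧ tsupport φ ⊆ Ω

/-- `u = (u.1, u.2)` represents an element of `H¹(Ω)`: the function `u.1 ∈ L₂(Ω)` has the weak
gradient `u.2 ∈ L₂(Ω)ᵐ`. An element of `H¹(Ω)` is thus carried together with its gradient, which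
is determined by the function. -/
def IsH1 {m : ℕ} (Ω : Set (Space m)) (u : L2 Ω × L2Vec Ω) : Prop :=
  ∀ φ : Space m → ℝ, IsTest Ω φ →
    ∫ x in Ω, u.1 x • gradient φ x = -∫ x in Ω, φ x • u.2 x

/-- `H¹₀(Ω)`: the closure of `C_c^∞(Ω)` in the norm of `H¹(Ω)`, each function being carried
together with its gradient. -/
def H10 {m : ℕ} (Ω : Set (Space m)) : Submodule ℝ (L2 Ω × L2Vec Ω) :=
  (Submodule.span ℝ {p : L2 Ω × L2Vec Ω | ∃ φ : Space m → ℝ, IsTest Ω φ ∧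
    p.1 =ᵐ[volume.restrict Ω] φ ∧ p.2 =ᵐ[volume.restrict Ω] gradient φ}).topologicalClosure

/-- `z = (z.1, z.2)` represents an element of `H(Ω, div)`: the vector field `z.1 ∈ L₂(Ω)ᵐ` has the
weak divergence `z.2 ∈ L₂(Ω)`. -/
def IsHdiv {m : ℕ} (Ω : Set (Space m)) (z : L2Vec Ω × L2 Ω) : Prop :=
  ∀ φ : Space m → ℝ, IsTest Ω φ →
    ∫ x in Ω, inner ℝ (z.1 x) (gradient φ x) = -∫ x in Ω, φ x * z.2 x

/-- A measurable field of symmetric matrices on `Ω`, with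
`μ₁ ξ·ξ ≤ A(x)ξ·ξ ≤ μ₂ ξ·ξ` and `μ₁ > 0`. -/
structure IsCoefficient {m : ℕ} (Ω : Set (Space m)) (A : Space m → Matrix (Fin m) (Fin m) ℝ)
    (μ₁ μ₂ : ℝ) : Prop where
  measurable : ∀ i j, AEMeasurable (fun x => A x i j) (volume.restrict Ω)
  symm : ∀ x ∈ Ω, (A x).IsSymm
  pos : 0 < μ₁
  lower : ∀ x ∈ Ω, ∀ ξ : Fin m → ℝ, μ₁ * (ξ ⬝ᵥ ξ) ≤ (A x *ᵥ ξ) ⬝ᵥ ξ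
  upper : ∀ x ∈ Ω, ∀ ξ : Fin m → ℝ, (A x *ᵥ ξ) ⬝ᵥ ξ ≤ μ₂ * (ξ ⬝ᵥ ξ)

/-- The bilinear form `∫_Ω A∇u·∇w + σ ∫_Ω u w`. -/
def form {m : ℕ} (Ω : Set (Space m)) (A : Space m → Matrix (Fin m) (Fin m) ℝ) (σ : ℝ)
    (u w : L2 Ω × L2Vec Ω) : ℝ :=
  (∫ x in Ω, (A x *ᵥ (u.2 x).ofLp) ⬝ᵥ (w.2 x).ofLp) + σ * ∫ x in Ω, u.1 x * w.1 x

/-- `‖u‖_A² = ∫_Ω ∇u·A∇u`. -/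
def sqNormA {m : ℕ} (Ω : Set (Space m)) (A : Space m → Matrix (Fin m) (Fin m) ℝ)
    (u : L2 Ω × L2Vec Ω) : ℝ :=
  ∫ x in Ω, (u.2 x).ofLp ⬝ᵥ (A x *ᵥ (u.2 x).ofLp)

/-- The squared energy norm `|||u|||² = ‖u‖_A² + σ ‖u‖²_{L₂(Ω)}`. -/
def sqEnergy {m : ℕ} (Ω : Set (Space m)) (A : Space m → Matrix (Fin m) (Fin m) ℝ) (σ : ℝ)
    (u : L2 Ω × L2Vec Ω) : ℝ :=
  sqNormA Ω A u + σ * ‖u.1‖ ^ 2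

/-- `u` is the weak solution of `-div(A∇u) + σu = f` in `Ω`, `u = ψ` on `∂Ω`. -/
def IsWeakSolution {m : ℕ} (Ω : Set (Space m)) (A : Space m → Matrix (Fin m) (Fin m) ℝ) (σ : ℝ)
    (f : L2 Ω) (ψ u : L2 Ω × L2Vec Ω) : Prop :=
  IsH1 Ω u ∧ u - ψ ∈ H10 Ω ∧
    ∀ w ∈ H10 Ω, form Ω A σ u w = ∫ x in Ω, f x * w.1 x

/-- `u_G ∈ V` is the Galerkin approximation from the subspace `V` of `H¹₀(Ω)`. -/
def IsGalerkin {m : ℕ} (Ω : Set (Space m)) (A : Space m → Matrix (Fin m) (Fin m) ℝ) (σ : ℝ)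
    (f : L2 Ω) (V : Submodule ℝ (L2 Ω × L2Vec Ω)) (uG : L2 Ω × L2Vec Ω) : Prop :=
  uG ∈ V ∧ ∀ w ∈ V, form Ω A σ uG w = ∫ x in Ω, f x * w.1 x

/-- The subspace `V` of `H¹₀(Ω)`, seen as a subspace of `L₂(Ω)`. -/
def toL2 {m : ℕ} {Ω : Set (Space m)} (V : Submodule ℝ (L2 Ω × L2Vec Ω)) : Submodule ℝ (L2 Ω) :=
  V.map (LinearMap.fst ℝ (L2 Ω) (L2Vec Ω))

/-- `θ = 1/σ_*` for `σ ≤ σ_*`, and `θ = 1/σ` for `σ > σ_*`. -/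
def thetaSmall (σ σs : ℝ) : ℝ := if σ ≤ σs then 1 / σs else 1 / σ

/-- `Θ = 2/(1+κ)` for `σ ≤ σ_*`, and `Θ = 1` for `σ > σ_*`, where `κ = σ/σ_*`. -/
def thetaBig (σ σs : ℝ) : ℝ := if σ ≤ σs then 2 / (1 + σ / σs) else 1

/-- `Θ₁ = (2+ε)/(1+κ)` for `σ ≤ σ_*/(1+ε)`, and `Θ₁ = 1+ε` for larger `σ`. -/
def thetaOne (σ σs ε : ℝ) : ℝ := if σ ≤ σs / (1 + ε) then (2 + ε) / (1 + σ / σs) else 1 + ε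

/-- `Θ₂ = 1 + 1/(1+κ⁻¹)`. -/
def thetaTwo (σ σs : ℝ) : ℝ := 1 + 1 / (1 + (σ / σs)⁻¹)

/-- `M(σ, σ_*, g, v, z) = ‖A∇v + z‖²_{A⁻¹} + θ ‖g - σv - div z‖²_{L₂(Ω)}`. -/
def majorant {m : ℕ} (Ω : Set (Space m)) (A : Space m → Matrix (Fin m) (Fin m) ℝ) (σ σs : ℝ)
    (g : Space m → ℝ) (v : L2 Ω × L2Vec Ω) (z : L2Vec Ω × L2 Ω) : ℝ :=
  (∫ x in Ω, ((A x)⁻¹ *ᵥ (A x *ᵥ (v.2 x).ofLp + (z.1 x).ofLp)) ⬝ᵥ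
      (A x *ᵥ (v.2 x).ofLp + (z.1 x).ofLp)) +
    thetaSmall σ σs * ∫ x in Ω, (g x - σ * v.1 x - z.2 x) ^ 2

/-- A partition of `Ω` into finitely many bounded convex open subdomains. -/
structure IsConvexPartition {m R : ℕ} (Ω : Set (Space m)) (τ : Fin R → Set (Space m)) :
    Prop where
  isOpen : ∀ r, IsOpen (τ r)
  convex : ∀ r, Convex ℝ (τ r)
  bounded : ∀ r, Bornology.IsBounded (τ r)
  disjoint : Pairwise fun r s => Disjoint (τ r) (τ s)
  cover : Ω = interior (⋃ r, closure (τ r))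

/-- The pairs `(c, b)` for which the polynomial `c + b·x` is square integrable. -/
def affineCoeffs {m : ℕ} (μ : Measure (Space m)) : Submodule ℝ (ℝ × Space m) where
  carrier := {p | MemLp (fun x => p.1 + inner ℝ p.2 x) 2 μ}
  add_mem' := by
    intro p q hp hq
    have h := MemLp.add hp hq
    refine h.ae_eq (Filter.Eventually.of_forall fun x => ?_)
    simp only [Pi.add_apply, Prod.fst_add, Prod.snd_add, inner_add_left]
    ring
  zero_mem' := by
    simp
  smul_mem' := by
    intro c p hp
    have h := MemLp.const_mul (c := c) hp
    refine h.ae_eq (Filter.Eventually.of_forall fun x => ?_)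
    simp only [Prod.smul_fst, Prod.smul_snd, smul_eq_mul, real_inner_smul_left]
    ring

theorem memLp_of_mem_affineCoeffs {m : ℕ} {μ : Measure (Space m)} {p : ℝ × Space m}
    (hp : p ∈ affineCoeffs μ) : MemLp (fun x => p.1 + inner ℝ p.2 x) 2 μ := hp

/-- The linear map sending `(c, b)` to the class of the polynomial `c + b·x` in `L₂(μ)`. -/
def affineToLp {m : ℕ} (μ : Measure (Space m)) : affineCoeffs μ →ₗ[ℝ] Lp ℝ 2 μ where
  toFun p := MemLp.toLp (fun x => p.1.1 + inner ℝ p.1.2 x) (memLp_of_mem_affineCoeffs p.2)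
  map_add' := by
    intro p q
    refine (MemLp.toLp_congr _ ((memLp_of_mem_affineCoeffs p.2).add
      (memLp_of_mem_affineCoeffs q.2)) (Filter.Eventually.of_forall fun x => ?_)).trans
      (MemLp.toLp_add _ _)
    simp only [Pi.add_apply, Submodule.coe_add, Prod.fst_add, Prod.snd_add, inner_add_left]
    ring
  map_smul' := by
    intro c p
    refine (MemLp.toLp_congr _ ((memLp_of_mem_affineCoeffs p.2).const_smul c)
      (Filter.Eventually.of_forall fun x => ?_)).trans (MemLp.toLp_const_smul _ _)
    simp only [Pi.smul_apply, Submodule.coe_smul, Prod.smul_fst, Prod.smul_snd, smul_eq_mul,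
      real_inner_smul_left]
    ring

/-- The polynomials of degree at most one, as a subspace of `L₂(μ)`. -/
def affinePolys {m : ℕ} (μ : Measure (Space m)) : Submodule ℝ (Lp ℝ 2 μ) :=
  LinearMap.range (affineToLp μ)

instance affinePolys_finiteDimensional {m : ℕ} (μ : Measure (Space m)) :
    FiniteDimensional ℝ (affinePolys μ) :=
  inferInstanceAs (FiniteDimensional ℝ (LinearMap.range (affineToLp μ)))

/-- `Π¹_τ f`: the orthogonal projection in `L₂(τ)` of the restriction of `f` to `τ ⊆ Ω` onto the
polynomials of degree at most one. -/
def localProj {m : ℕ} {Ω : Set (Space m)} (τ : Set (Space m)) (f : L2 Ω) :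
    Lp ℝ 2 ((volume.restrict Ω).restrict τ) :=
  (affinePolys ((volume.restrict Ω).restrict τ)).starProjection
    (LpToLpRestrictCLM (Space m) ℝ ℝ (volume.restrict Ω) 2 τ f)

/-- The piecewise projection `f̂`, equal to `Π¹_r f` on `τ_r`. -/
def piecewiseProj {m R : ℕ} {Ω : Set (Space m)} (τ : Fin R → Set (Space m)) (f : L2 Ω) :
    Space m → ℝ :=
  fun x => ∑ r, (τ r).indicator (localProj (τ r) f) x

end ReactionDiffusion

end

open ReactionDiffusion

/-!
The error `e = v - u` lies in `H¹₀(Ω)`, so the weak equation and integration by parts of the test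
flux `z` against `e` give, for every `g ∈ L₂(Ω)`,
`|||e|||² = ∫ (A∇v + z)·∇e - ∫ (g - σv - div z) e - ∫ (f - g) e`
(`form_sub_inner_eq`). Young's inequality, with `A` and `A⁻¹` as a dual pair in the first integral,
bounds twice the right-hand side by a multiple `T` of the majorant plus `T⁻¹` times a combination of
`‖e‖_A²` and `‖e‖²` (`two_mul_sqEnergy_le`). The factors in the theorem are the smallest `T` for
which this combination is at most `T |||e|||²` whenever `σ_* ‖e‖² ≤ ‖e‖_A²`. For Galerkin
approximations, orthogonality replaces `e` in the residual by `w - u`, where `w ∈ V` has the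
`L₂`-component `Qu`; the flux term vanishes.

The data oscillation `∫ (f - f̂) e` on a subdomain `τ` is the only place where more than Hilbert
space arguments is needed. Since `f - Π¹f` is orthogonal to constants, `e` may be replaced by
`e - c`, and the Payne–Weinberger inequality `‖e - c‖ ≤ (diam τ / π) ‖∇e‖` on convex sets applies.
It suffices to have it for test functions, as these are dense in `H¹₀(Ω)`
(`sq_inner_restrict_le`).

The Payne–Weinberger inequality is proved by localization. If it fails for `φ` with mean value zero
on `K`, then bisection by hyperplanes, each of which contains a prescribed plane of codimension two
and halves the integral of `φ`, yields ever smaller convex sets on which `φ` has mean value zero and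
the inequality fails with a uniform margin. When the prescribed planes run through all
`x i = r, x j = s` with rational `r, s`, the intersection of the sets lies in a line, so some of
them lie in arbitrarily thin tubes (`IsPiece.exists_needle`). There `φ` is nearly a function of the
coordinate along the tube. For such functions the inequality is one-dimensional, with the marginal
of the convex set as weight (`ridge_inequality`). The marginal, mollified by a Gaussian, is smooth
and log-concave by the Prékopa–Leindler inequality (`marginal_mul_le`). For a smooth log-concave
weight `p` on `[a, b]`, the flux `W = ∫ₐ u p` vanishes at both ends, and the claim reduces to
`(π / (b - a))² ∫ W²/p ≤ ∫ W'²/p`, which follows by completing a square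
(`sq_mul_integral_sq_div_le`).
-/

/-! ### The Prékopa–Leindler inequality -/

namespace PrekopaLeindler

open scoped ENNReal

/-- The one-dimensional Brunn–Minkowski inequality `|A| + |B| ≤ 2 |(A + B) / 2|` for compact sets:
the translates `A + min B` and `max A + B` lie in `A + B` and meet in one point only. -/
theorem volume_add_le_of_isCompact {A B S : Set ℝ} (hA : IsCompact A) (hB : IsCompact B)
    (hA0 : A.Nonempty) (hB0 : B.Nonempty) (hS : ∀ x ∈ A, ∀ y ∈ B, (x + y) / 2 ∈ S) :
    volume A + volume B ≤ 2 * volume S := by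
  obtain ⟨a, haA, ha⟩ := hA.exists_isGreatest hA0
  obtain ⟨b, hbB, hb⟩ := hB.exists_isLeast hB0
  have h1 : volume ((fun x => x + b) '' A) = volume A := by
    simp
  have h2 : volume ((fun x => a + x) '' B) = volume B := by
    simp
  have h3 : volume ((fun x : ℝ => 2 * x) '' S) = 2 * volume S := by
    have := Measure.addHaar_smul (volume : Measure ℝ) 2 S
    rw [← Set.image_smul] at this
    simpa using this
  rw [← h3, ← h1, ← h2, ← measure_union₀' ]
  · refine measure_mono ?_
    rintro _ (⟨x, hx, rfl⟩ | ⟨x, hx, rfl⟩)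
    · exact ⟨_, hS x hx b hbB, by ring⟩
    · exact ⟨_, hS a haA x hx, by ring⟩
  · exact (hA.image (by fun_prop)).measurableSet.nullMeasurableSet
  · refine measure_mono_null (t := {a + b}) ?_ (by simp)
    rintro _ ⟨⟨x, hx, rfl⟩, ⟨y, hy, h⟩⟩
    have := ha hx
    have := hb hy
    simp only [Set.mem_singleton_iff] at *
    linarith

/-- The one-dimensional Brunn–Minkowski inequality for measurable sets. -/
theorem volume_add_le {A B S : Set ℝ} (hA : MeasurableSet A) (hB : MeasurableSet B)
    (hA0 : A.Nonempty) (hB0 : B.Nonempty) (hS : ∀ x ∈ A, ∀ y ∈ B, (x + y) / 2 ∈ S) :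
    volume A + volume B ≤ 2 * volume S := by
  obtain ⟨a, ha⟩ := hA0
  obtain ⟨b, hb⟩ := hB0
  rw [hA.measure_eq_iSup_isCompact, hB.measure_eq_iSup_isCompact]
  simp_rw [iSup_and']
  refine ENNReal.biSup_add_biSup_le' ⟨∅, by simp⟩ ⟨∅, by simp⟩ ?_
  rintro K ⟨hKA, hK⟩ L ⟨hLB, hL⟩
  calc volume K + volume L ≤ volume (insert a K) + volume (insert b L) := by
        gcongr <;> exact Set.subset_insert _ _
    _ ≤ 2 * volume S := by
        refine volume_add_le_of_isCompact (hK.insert a) (hL.insert b) (Set.insert_nonempty _ _)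
          (Set.insert_nonempty _ _) fun x hx y hy => hS x ?_ y ?_
        · exact Set.insert_subset ha hKA hx
        · exact Set.insert_subset hb hLB hy

/-- The Prékopa–Leindler inequality on the line, for functions with supremum one; here it holds in
the stronger arithmetic form, by the Brunn–Minkowski inequality for the superlevel sets. -/
theorem lintegral_add_le_of_sup_eq_one {f g h : ℝ → ℝ} (hf : Measurable f) (hg : Measurable g)
    (hh : Measurable h) (hf0 : 0 ≤ f) (hg0 : 0 ≤ g) (hh0 : 0 ≤ h) (hf1 : ∀ x, f x ≤ 1)
    (hg1 : ∀ x, g x ≤ 1) (hfs : ∀ a, 0 < a → a < 1 → ∃ x, a < f x)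
    (hgs : ∀ a, 0 < a → a < 1 → ∃ x, a < g x)
    (H : ∀ x y, f x * g y ≤ h ((x + y) / 2) ^ 2) :
    (∫⁻ x, ENNReal.ofReal (f x)) + ∫⁻ x, ENNReal.ofReal (g x) ≤
      2 * ∫⁻ x, ENNReal.ofReal (h x) := by
  have meas : ∀ k : ℝ → ℝ, Measurable fun t : ℝ => volume {x | t < k x} := fun k =>
    (show Antitone fun t : ℝ => volume {x | t < k x} from fun s t hst =>
      measure_mono fun x (hx : t < k x) => lt_of_le_of_lt hst hx).measurable
  rw [lintegral_eq_lintegral_meas_lt _ (.of_forall hf0) hf.aemeasurable,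
    lintegral_eq_lintegral_meas_lt _ (.of_forall hg0) hg.aemeasurable,
    lintegral_eq_lintegral_meas_lt _ (.of_forall hh0) hh.aemeasurable,
    ← lintegral_add_left (meas f), ← lintegral_const_mul _ (meas h)]
  refine setLIntegral_mono ((meas h).const_mul 2) fun t (ht : 0 < t) => ?_
  rcases lt_or_ge t 1 with h1 | h1
  · refine volume_add_le (measurableSet_lt measurable_const hf)
      (measurableSet_lt measurable_const hg) (hfs t ht h1) (hgs t ht h1) fun x hx y hy => ?_
    refine lt_of_pow_lt_pow_left₀ 2 (hh0 _) (lt_of_lt_of_le ?_ (H x y))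
    rw [sq]
    exact mul_lt_mul'' hx hy ht.le ht.le
  · have e : ∀ k : ℝ → ℝ, (∀ x, k x ≤ 1) → {x | t < k x} = ∅ := fun k hk =>
      Set.eq_empty_of_forall_notMem fun x (hx : t < k x) => absurd (hk x) (by linarith)
    simp [e f hf1, e g hg1]

theorem mul_le_sq_of_add_le {a b c : ℝ≥0∞} (h : a + b ≤ 2 * c) : a * b ≤ c ^ 2 := by
  rcases eq_or_ne c ⊤ with rfl | hc
  · simp
  have h2 : a + b ≠ ⊤ := ne_top_of_le_ne_top (by finiteness) h
  obtain ⟨ha, hb⟩ := ENNReal.add_ne_top.1 h2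
  lift a to NNReal using ha
  lift b to NNReal using hb
  lift c to NNReal using hc
  norm_cast at h ⊢
  have h' : (a : ℝ) + b ≤ 2 * c := by exact_mod_cast h
  have : (a : ℝ) * b ≤ c ^ 2 := by
    nlinarith [sq_nonneg ((a : ℝ) - b), a.2, b.2, c.2, add_nonneg a.2 b.2,
      pow_le_pow_left₀ (add_nonneg a.2 b.2) h' 2]
  exact_mod_cast this

theorem lintegral_mul_le_real_of_bounded {f g h : ℝ → ℝ≥0∞} (hf : Measurable f)
    (hg : Measurable g) (hh : Measurable h) (hfb : ⨆ x, f x ≠ ⊤) (hgb : ⨆ x, g x ≠ ⊤)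
    (H : ∀ x y, f x * g y ≤ h ((x + y) / 2) ^ 2) :
    (∫⁻ x, f x) * ∫⁻ x, g x ≤ (∫⁻ x, h x) ^ 2 := by
  set M := ⨆ x, f x with hM
  set N := ⨆ x, g x with hN
  rcases eq_or_ne M 0 with hM0 | hM0
  · have : ∀ x, f x = 0 := by simpa [hM] using hM0
    simp [this]
  rcases eq_or_ne N 0 with hN0 | hN0
  · have : ∀ x, g x = 0 := by simpa [hN] using hN0
    simp [this]
  obtain ⟨C, hC⟩ : ∃ C : ℝ≥0∞, C ^ 2 = M * N :=
    ⟨(M * N) ^ (1 / 2 : ℝ), by rw [← ENNReal.rpow_natCast, ← ENNReal.rpow_mul]; simp⟩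
  have hMN : M * N ≠ ⊤ := ENNReal.mul_ne_top hfb hgb
  have hC0 : C ≠ 0 := by
    rintro rfl
    simp [hM0, hN0] at hC
  have hCt : C ≠ ⊤ := by
    rintro rfl
    exact hMN (by rw [← hC]; simp)
  have key : ∀ (k : ℝ → ℝ≥0∞) (D : ℝ≥0∞), D = ⨆ x, k x → D ≠ 0 → D ≠ ⊤ → Measurable k →
      Measurable (fun x => (k x / D).toReal) ∧ (∀ x, (k x / D).toReal ≤ 1) ∧
      (∀ a, 0 < a → a < 1 → ∃ x, a < (k x / D).toReal) ∧
      (∫⁻ x, k x) = D * ∫⁻ x, ENNReal.ofReal (k x / D).toReal := by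
    intro k D hD hD0 hDt hk
    have hle : ∀ x, k x ≤ D := fun x => hD ▸ le_iSup k x
    have hle1 : ∀ x, k x / D ≤ 1 := fun x =>
      ENNReal.div_le_of_le_mul (by simpa using hle x)
    have hne : ∀ x, k x / D ≠ ⊤ := fun x => ne_top_of_le_ne_top ENNReal.one_ne_top (hle1 x)
    refine ⟨(hk.div_const D).ennreal_toReal, fun x => ?_, fun a ha0 ha => ?_, ?_⟩
    · exact ENNReal.toReal_mono ENNReal.one_ne_top (hle1 x)
    · have h1 : ENNReal.ofReal a * D < D := by
        conv_rhs => rw [← one_mul D]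
        refine (ENNReal.mul_lt_mul_iff_left hD0 hDt).2 ?_
        rwa [← ENNReal.ofReal_one, ENNReal.ofReal_lt_ofReal_iff one_pos]
      obtain ⟨x, hx⟩ := lt_iSup_iff.1 (lt_of_lt_of_eq h1 hD)
      refine ⟨x, (ENNReal.ofReal_lt_iff_lt_toReal ha0.le (hne x)).1 ?_⟩
      exact (ENNReal.lt_div_iff_mul_lt (.inl hD0) (.inl hDt)).2 hx
    · rw [← lintegral_const_mul _ (hk.div_const D).ennreal_toReal.ennreal_ofReal]
      refine lintegral_congr fun x => ?_
      rw [ENNReal.ofReal_toReal (hne x), ENNReal.mul_div_cancel hD0 hDt]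
  obtain ⟨f1, f2, f3, f4⟩ := key f M hM hM0 hfb hf
  obtain ⟨g1, g2, g3, g4⟩ := key g N hN hN0 hgb hg
  have hht : ∀ x, min (h x / C) 1 ≠ ⊤ := fun x => by simp
  have main := lintegral_add_le_of_sup_eq_one (h := fun x => (min (h x / C) 1).toReal) f1 g1
    ((hh.div_const C).min measurable_const).ennreal_toReal (fun _ => ENNReal.toReal_nonneg)
    (fun _ => ENNReal.toReal_nonneg) (fun _ => ENNReal.toReal_nonneg) f2 g2 f3 g3 (by
      intro x y
      rw [← ENNReal.toReal_mul, ← ENNReal.toReal_pow]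
      refine ENNReal.toReal_mono (ENNReal.pow_ne_top (hht _)) ?_
      rcases le_total (h ((x + y) / 2) / C) 1 with h1 | h1
      · rw [min_eq_left h1, ENNReal.div_eq_inv_mul, ENNReal.div_eq_inv_mul, ENNReal.div_eq_inv_mul,
          mul_pow, ← ENNReal.inv_pow, hC, ENNReal.mul_inv (.inl hM0) (.inl hfb)]
        calc _ = M⁻¹ * N⁻¹ * (f x * g y) := by ring
          _ ≤ _ := by gcongr; exact H x y
      · rw [min_eq_right h1, one_pow]
        refine mul_le_one' ?_ ?_
        · exact ENNReal.div_le_of_le_mul (by simpa using le_iSup f x)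
        · exact ENNReal.div_le_of_le_mul (by simpa using le_iSup g y))
  have hhC : C * ∫⁻ x, ENNReal.ofReal (min (h x / C) 1).toReal ≤ ∫⁻ x, h x := by
    rw [← lintegral_const_mul _
      ((hh.div_const C).min measurable_const).ennreal_toReal.ennreal_ofReal]
    refine lintegral_mono fun x => ?_
    rw [ENNReal.ofReal_toReal (hht x)]
    calc C * min (h x / C) 1 ≤ C * (h x / C) := by gcongr; exact min_le_left _ _
      _ = h x := ENNReal.mul_div_cancel hC0 hCt
  calc (∫⁻ x, f x) * ∫⁻ x, g x
      = C ^ 2 * ((∫⁻ x, ENNReal.ofReal (f x / M).toReal) *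
          ∫⁻ x, ENNReal.ofReal (g x / N).toReal) := by rw [f4, g4, hC]; ring
    _ ≤ C ^ 2 * (∫⁻ x, ENNReal.ofReal (min (h x / C) 1).toReal) ^ 2 := by
        gcongr; exact mul_le_sq_of_add_le main
    _ = (C * ∫⁻ x, ENNReal.ofReal (min (h x / C) 1).toReal) ^ 2 := by rw [mul_pow]
    _ ≤ _ := by gcongr

/-- The Prékopa–Leindler inequality on the line. -/
theorem lintegral_mul_le_real {f g h : ℝ → ℝ≥0∞} (hf : Measurable f)
    (hg : Measurable g) (hh : Measurable h)
    (H : ∀ x y, f x * g y ≤ h ((x + y) / 2) ^ 2) :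
    (∫⁻ x, f x) * ∫⁻ x, g x ≤ (∫⁻ x, h x) ^ 2 := by
  have key : ∀ k : ℝ → ℝ≥0∞, Measurable k →
      ∫⁻ x, k x = ⨆ n : ℕ, ∫⁻ x, min (k x) n := by
    intro k hk
    rw [← lintegral_iSup (fun n => hk.min measurable_const)
      (fun n m hnm x => min_le_min le_rfl (by exact_mod_cast hnm))]
    refine lintegral_congr fun x => ?_
    rw [← inf_iSup_eq, ENNReal.iSup_natCast]; simp
  rw [key f hf, key g hg, ENNReal.iSup_mul]
  refine iSup_le fun n => ?_
  rw [ENNReal.mul_iSup]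
  refine iSup_le fun m => ?_
  refine lintegral_mul_le_real_of_bounded (hf.min measurable_const) (hg.min measurable_const) hh
    ?_ ?_ fun x y => le_trans ?_ (H x y)
  · exact ne_top_of_le_ne_top (ENNReal.natCast_ne_top n) (iSup_le fun x => min_le_right _ _)
  · exact ne_top_of_le_ne_top (ENNReal.natCast_ne_top m) (iSup_le fun x => min_le_right _ _)
  · gcongr <;> exact min_le_left _ _

/-- The Prékopa–Leindler inequality on `ℝⁿ`, by induction on the dimension: the integrals over the
slices satisfy the hypothesis of the one-dimensional inequality. -/
theorem lintegral_mul_le_pi {n : ℕ} {f g h : (Fin n → ℝ) → ℝ≥0∞} (hf : Measurable f)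
    (hg : Measurable g) (hh : Measurable h)
    (H : ∀ x y, f x * g y ≤ h ((2⁻¹ : ℝ) • (x + y)) ^ 2) :
    (∫⁻ x, f x) * ∫⁻ x, g x ≤ (∫⁻ x, h x) ^ 2 := by
  induction n with
  | zero =>
    have e : ∀ k : (Fin 0 → ℝ) → ℝ≥0∞, ∫⁻ x, k x = k 0 := fun k => by
      rw [volume_pi, Measure.pi_of_empty, lintegral_dirac]
      congr 1
      exact Subsingleton.elim _ _
    rw [e, e, e]
    simpa using H 0 0
  | succ n ih =>
    let E := (MeasurableEquiv.piFinSuccAbove (fun _ : Fin (n + 1) => ℝ) 0).symm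
    have hE : MeasurePreserving E :=
      (volume_preserving_piFinSuccAbove (fun _ : Fin (n + 1) => ℝ) 0).symm _
    have e : ∀ k : (Fin (n + 1) → ℝ) → ℝ≥0∞, Measurable k →
        ∫⁻ x, k x = ∫⁻ s, ∫⁻ y, k (E (s, y)) := fun k hk => by
      rw [← hE.lintegral_comp hk, Measure.volume_eq_prod,
        lintegral_prod (fun p => k (E p)) (hk.comp E.measurable).aemeasurable]
    have hm : ∀ k : (Fin (n + 1) → ℝ) → ℝ≥0∞, Measurable k →
        Measurable fun s => ∫⁻ y, k (E (s, y)) := fun k hk =>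
      (hk.comp E.measurable).lintegral_prod_right'
    rw [e f hf, e g hg, e h hh]
    refine lintegral_mul_le_real (hm f hf) (hm g hg) (hm h hh) fun s t => ?_
    have hs : ∀ s : ℝ, Measurable fun y => E (s, y) := fun s =>
      E.measurable.comp measurable_prodMk_left
    refine ih (hf.comp (hs s)) (hg.comp (hs t)) (hh.comp (hs _)) fun x y => ?_
    have : E ((s + t) / 2, (2⁻¹ : ℝ) • (x + y)) = (2⁻¹ : ℝ) • (E (s, x) + E (t, y)) := by
      ext i
      refine Fin.cases ?_ (fun j => ?_) i
      · simp [E, MeasurableEquiv.piFinSuccAbove]; ring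
      · simp [E, MeasurableEquiv.piFinSuccAbove, mul_add]
    rw [this]
    exact H _ _

/-- The Prékopa–Leindler inequality on Euclidean space. -/
theorem lintegral_mul_le {m : ℕ} {f g h : Space m → ℝ≥0∞} (hf : Measurable f)
    (hg : Measurable g) (hh : Measurable h)
    (H : ∀ x y, f x * g y ≤ h ((2⁻¹ : ℝ) • (x + y)) ^ 2) :
    (∫⁻ x, f x) * ∫⁻ x, g x ≤ (∫⁻ x, h x) ^ 2 := by
  have hE := EuclideanSpace.volume_preserving_symm_measurableEquiv_toLp (Fin m)
  have hE' := hE.symm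
  have e : ∀ k : Space m → ℝ≥0∞, Measurable k → ∫⁻ x, k x = ∫⁻ y : Fin m → ℝ, k (WithLp.toLp 2 y) :=
    fun k hk => by
      rw [← hE'.lintegral_comp hk]; rfl
  have hT : Measurable (WithLp.toLp 2 : (Fin m → ℝ) → Space m) :=
    (MeasurableEquiv.toLp 2 (Fin m → ℝ)).measurable
  rw [e f hf, e g hg, e h hh]
  exact lintegral_mul_le_pi (hf.comp hT) (hg.comp hT) (hh.comp hT) fun x y => H _ _

end PrekopaLeindler

/-! ### The weighted Poincaré inequality on an interval -/

namespace PayneWeinberger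

open Real Set

/-- A Dirichlet inequality for the log-convex weight `1/p`. With `r = -p'/(2p) + k tan (k (x - c))`,
`c` the midpoint, the square `(W' + rW)²/p` equals
`W'²/p + (rW²/p)' - (k² + nonnegative) W²/p`. -/
theorem sq_mul_integral_sq_div_le {a b k : ℝ} (hab : a ≤ b) (hk : 0 < k) (hkab : k * (b - a) < π)
    {p p' p'' W W' : ℝ → ℝ} (hp : ∀ x, 0 < p x) (hp1 : ∀ x, HasDerivAt p (p' x) x)
    (hp2 : ∀ x, HasDerivAt p' (p'' x) x) (hp3 : Continuous p'')
    (hlog : ∀ x, p x * p'' x ≤ p' x ^ 2) (hW : ∀ x, HasDerivAt W (W' x) x)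
    (hW' : Continuous W') (hWa : W a = 0) (hWb : W b = 0) :
    k ^ 2 * ∫ x in a..b, W x ^ 2 / p x ≤ ∫ x in a..b, W' x ^ 2 / p x := by
  have cp : Continuous p := continuous_iff_continuousAt.2 fun x => (hp1 x).continuousAt
  have cp' : Continuous p' := continuous_iff_continuousAt.2 fun x => (hp2 x).continuousAt
  have cW : Continuous W := continuous_iff_continuousAt.2 fun x => (hW x).continuousAt
  have hp0 : ∀ x, p x ≠ 0 := fun x => (hp x).ne'
  set c := (a + b) / 2 with hc
  have hcos : ∀ x ∈ Icc a b, 0 < cos (k * (x - c)) := fun x hx => by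
    refine cos_pos_of_mem_Ioo ⟨?_, ?_⟩
    · nlinarith [hx.1, hx.2]
    · nlinarith [hx.1, hx.2]
  let q : ℝ → ℝ := fun x => k * tan (k * (x - c))
  let G : ℝ → ℝ := fun x => (-p' x / (2 * p x) + q x) * (W x ^ 2 / p x)
  let G' : ℝ → ℝ := fun x =>
    (-(p'' x * p x - p' x ^ 2) / (2 * p x ^ 2) + (k ^ 2 + q x ^ 2)) * (W x ^ 2 / p x) +
      (-p' x / (2 * p x) + q x) * ((2 * W x * W' x * p x - W x ^ 2 * p' x) / p x ^ 2)
  have cq : ContinuousOn q (Icc a b) := by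
    refine continuousOn_const.mul ?_
    intro x hx
    have : ContinuousAt (fun x => tan (k * (x - c))) x :=
      (continuousAt_tan.2 (hcos x hx).ne').comp (f := fun x => k * (x - c)) (by fun_prop)
    exact this.continuousWithinAt
  have dG : ∀ x ∈ Icc a b, HasDerivAt G (G' x) x := by
    intro x hx
    have dq : HasDerivAt q (k ^ 2 + q x ^ 2) x := by
      have h1 : HasDerivAt (fun y => k * (y - c)) (k * 1) x :=
        ((hasDerivAt_id x).sub_const c).const_mul k
      have h2 := ((hasDerivAt_tan (hcos x hx).ne').comp x h1).const_mul k
      refine h2.congr_deriv ?_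
      simp only [q]
      rw [tan_eq_sin_div_cos]
      have := (hcos x hx).ne'
      field_simp
      linear_combination (-(1 : ℝ)) * sin_sq_add_cos_sq (k * (x - c))
    have d1 : HasDerivAt (fun y => -p' y / (2 * p y))
        (-(p'' x * p x - p' x ^ 2) / (2 * p x ^ 2)) x := by
      refine (((hp2 x).neg).div ((hp1 x).const_mul 2) (mul_ne_zero two_ne_zero (hp0 x))).congr_deriv
        ?_
      have := hp0 x
      simp only [Pi.neg_apply]
      field_simp
      ring
    have d2 : HasDerivAt (fun y => W y ^ 2 / p y)
        ((2 * W x * W' x * p x - W x ^ 2 * p' x) / p x ^ 2) x := by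
      refine (((hW x).pow 2).div (hp1 x) (hp0 x)).congr_deriv ?_
      simp
    exact (d1.add dq).mul d2
  have c1 : Continuous fun x => W x ^ 2 / p x := by fun_prop (disch := simp [hp0])
  have c2 : Continuous fun x => W' x ^ 2 / p x := by fun_prop (disch := simp [hp0])
  have cG' : ContinuousOn G' (Icc a b) := by
    have e1 : Continuous fun x => -(p'' x * p x - p' x ^ 2) / (2 * p x ^ 2) := by
      fun_prop (disch := simp [hp0])
    have e2 : Continuous fun x => -p' x / (2 * p x) := by
      fun_prop (disch := simp [hp0])
    have e3 : Continuous fun x => (2 * W x * W' x * p x - W x ^ 2 * p' x) / p x ^ 2 := by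
      fun_prop (disch := simp [hp0])
    exact ((e1.continuousOn.add (continuousOn_const.add (cq.pow 2))).mul c1.continuousOn).add
      ((e2.continuousOn.add cq).mul e3.continuousOn)
  have iG' : IntervalIntegrable G' volume a b :=
    ContinuousOn.intervalIntegrable (by rwa [uIcc_of_le hab])
  have hG : ∫ x in a..b, G' x = 0 := by
    rw [intervalIntegral.integral_eq_sub_of_hasDerivAt (f := G)
      (fun x hx => dG x (by rwa [uIcc_of_le hab] at hx)) iG']
    simp [G, hWa, hWb]
  have main : ∫ x in a..b, k ^ 2 * (W x ^ 2 / p x) ≤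
      ∫ x in a..b, (W' x ^ 2 / p x + G' x) := by
    refine intervalIntegral.integral_mono_on hab
      ((c1.const_mul _).intervalIntegrable _ _) ((c2.intervalIntegrable _ _).add iG') ?_
    intro x _
    have h0 := hp0 x
    have hP := hp x
    have h1 : 0 ≤ (p' x ^ 2 - p x * p'' x) * (W x ^ 2 / (2 * p x ^ 3)) :=
      mul_nonneg (sub_nonneg.2 (hlog x)) (by positivity)
    have h2 : 0 ≤ (W' x + (-p' x / (2 * p x) + q x) * W x) ^ 2 / p x := by positivity
    have h3 : 0 ≤ (p' x * W x) ^ 2 / (4 * p x ^ 3) := by positivity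
    have e : W' x ^ 2 / p x + G' x - k ^ 2 * (W x ^ 2 / p x) =
        (W' x + (-p' x / (2 * p x) + q x) * W x) ^ 2 / p x +
        (p' x ^ 2 - p x * p'' x) * (W x ^ 2 / (2 * p x ^ 3)) +
          (p' x * W x) ^ 2 / (4 * p x ^ 3) := by
      simp only [G']
      field_simp
      ring
    linarith
  rw [intervalIntegral.integral_const_mul, intervalIntegral.integral_add
    (c2.intervalIntegrable _ _) iG', hG, add_zero] at main
  exact main

/-- The Payne–Weinberger inequality on an interval with a smooth log-concave weight `p`, for
functions of weighted mean zero: the flux `W = ∫ₐ u p` vanishes at both ends. -/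
theorem integral_sq_mul_le_of_mean_zero {a b : ℝ} (hab : a < b)
    {p p' p'' u u' : ℝ → ℝ} (hp : ∀ x, 0 < p x) (hp1 : ∀ x, HasDerivAt p (p' x) x)
    (hp2 : ∀ x, HasDerivAt p' (p'' x) x) (hp3 : Continuous p'')
    (hlog : ∀ x, p x * p'' x ≤ p' x ^ 2) (hu : ∀ x, HasDerivAt u (u' x) x)
    (hu' : Continuous u') (hmean : ∫ x in a..b, u x * p x = 0) :
    ∫ x in a..b, u x ^ 2 * p x ≤ ((b - a) / π) ^ 2 * ∫ x in a..b, u' x ^ 2 * p x := by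
  have cp : Continuous p := continuous_iff_continuousAt.2 fun x => (hp1 x).continuousAt
  have cu : Continuous u := continuous_iff_continuousAt.2 fun x => (hu x).continuousAt
  have hp0 : ∀ x, p x ≠ 0 := fun x => (hp x).ne'
  have hba : 0 < b - a := sub_pos.2 hab
  let W : ℝ → ℝ := fun x => ∫ y in a..x, u y * p y
  have hW : ∀ x, HasDerivAt W (u x * p x) x := fun x =>
    (cu.mul cp).integral_hasStrictDerivAt a x |>.hasDerivAt
  have cW : Continuous W := continuous_iff_continuousAt.2 fun x => (hW x).continuousAt
  have hWa : W a = 0 := intervalIntegral.integral_same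
  set I := ∫ x in a..b, u x ^ 2 * p x with hI
  set J := ∫ x in a..b, u' x ^ 2 * p x with hJ
  have c1 : Continuous fun x => u' x ^ 2 * p x := by fun_prop
  have c2 : Continuous fun x => W x ^ 2 / p x := by fun_prop (disch := simp [hp0])
  have parts : I = -∫ x in a..b, u' x * W x := by
    have := intervalIntegral.integral_mul_deriv_eq_deriv_mul (a := a) (b := b) (u := u) (v := W)
      (u' := u') (v' := fun x => u x * p x) (fun x _ => hu x) (fun x _ => hW x)
      (hu'.intervalIntegrable _ _) ((cu.mul cp).intervalIntegrable _ _)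
    rw [hWa, show W b = 0 from hmean] at this
    simp only [mul_zero, sub_zero, zero_sub] at this
    rw [← this]
    refine intervalIntegral.integral_congr fun x _ => ?_
    ring
  have hk : ∀ k, 0 < k → k * (b - a) < π → k ^ 2 * I ≤ J := by
    intro k hk hkab
    have h1 := sq_mul_integral_sq_div_le hab.le hk hkab hp hp1 hp2 hp3 hlog hW (cu.mul cp) hWa hmean
    have h2 : ∫ x in a..b, (u x * p x) ^ 2 / p x = I := by
      refine intervalIntegral.integral_congr fun x _ => ?_
      have := hp0 x
      field_simp
    rw [h2] at h1
    have h3 : ∫ x in a..b, -(2 * k ^ 2) * (u' x * W x) ≤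
        ∫ x in a..b, (u' x ^ 2 * p x + k ^ 4 * (W x ^ 2 / p x)) := by
      refine intervalIntegral.integral_mono_on hab.le
        (Continuous.intervalIntegrable (by fun_prop) _ _)
        (Continuous.intervalIntegrable (by fun_prop) _ _) ?_
      intro x _
      have h0 := hp0 x
      have hP := hp x
      have e : u' x ^ 2 * p x + k ^ 4 * (W x ^ 2 / p x) - -(2 * k ^ 2) * (u' x * W x) =
        (u' x * p x + k ^ 2 * W x) ^ 2 / p x := by
        field_simp
        ring
      have : 0 ≤ (u' x * p x + k ^ 2 * W x) ^ 2 / p x := by positivity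
      linarith
    rw [intervalIntegral.integral_const_mul, intervalIntegral.integral_add
      (c1.intervalIntegrable _ _) ((c2.const_mul _).intervalIntegrable _ _),
      intervalIntegral.integral_const_mul] at h3
    have h4 := mul_le_mul_of_nonneg_left h1 (sq_nonneg k)
    nlinarith
  have lim : (π / (b - a)) ^ 2 * I ≤ J := by
    have ht : Filter.Tendsto (fun k : ℝ => k ^ 2 * I) (nhdsWithin (π / (b - a)) (Iio (π / (b - a))))
        (nhds ((π / (b - a)) ^ 2 * I)) :=
      (Continuous.tendsto (by fun_prop) _).mono_left nhdsWithin_le_nhds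
    refine le_of_tendsto ht ?_
    filter_upwards [Ioo_mem_nhdsLT (show 0 < π / (b - a) by positivity)] with k hk'
    exact hk k hk'.1 ((lt_div_iff₀ hba).1 hk'.2)
  have := mul_le_mul_of_nonneg_left lim (sq_nonneg ((b - a) / π))
  calc I = ((b - a) / π) ^ 2 * ((π / (b - a)) ^ 2 * I) := by
        have := pi_pos.ne'
        field_simp
    _ ≤ _ := this

/-- The Payne–Weinberger inequality on an interval with a smooth log-concave weight `p`, with the
mean value written out. -/
theorem integral_mul_integral_sq_le {a b : ℝ} (hab : a < b)
    {p p' p'' u u' : ℝ → ℝ} (hp : ∀ x, 0 < p x) (hp1 : ∀ x, HasDerivAt p (p' x) x)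
    (hp2 : ∀ x, HasDerivAt p' (p'' x) x) (hp3 : Continuous p'')
    (hlog : ∀ x, p x * p'' x ≤ p' x ^ 2) (hu : ∀ x, HasDerivAt u (u' x) x)
    (hu' : Continuous u') :
    (∫ x in a..b, p x) * (∫ x in a..b, u x ^ 2 * p x) - (∫ x in a..b, u x * p x) ^ 2 ≤
      ((b - a) / π) ^ 2 * ((∫ x in a..b, p x) * ∫ x in a..b, u' x ^ 2 * p x) := by
  have cp : Continuous p := continuous_iff_continuousAt.2 fun x => (hp1 x).continuousAt
  have cu : Continuous u := continuous_iff_continuousAt.2 fun x => (hu x).continuousAt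
  set P := ∫ x in a..b, p x with hP
  have hP0 : 0 < P := intervalIntegral.intervalIntegral_pos_of_pos_on
    (cp.intervalIntegrable _ _) (fun x _ => hp x) hab
  set m := (∫ x in a..b, u x * p x) / P with hm
  have e1 : ∫ x in a..b, (u x - m) * p x = 0 := by
    have : ∀ x, (u x - m) * p x = u x * p x - m * p x := fun x => by ring
    simp_rw [this]
    rw [intervalIntegral.integral_sub (Continuous.intervalIntegrable (by fun_prop) _ _)
      (Continuous.intervalIntegrable (by fun_prop) _ _), intervalIntegral.integral_const_mul,
      ← hP, hm]
    field_simp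
    simp
  have e2 : ∫ x in a..b, (u x - m) ^ 2 * p x =
      (∫ x in a..b, u x ^ 2 * p x) - 2 * m * (∫ x in a..b, u x * p x) + m ^ 2 * P := by
    have : ∀ x, (u x - m) ^ 2 * p x = u x ^ 2 * p x - 2 * m * (u x * p x) + m ^ 2 * p x :=
      fun x => by ring
    simp_rw [this]
    rw [intervalIntegral.integral_add (Continuous.intervalIntegrable (by fun_prop) _ _)
      (Continuous.intervalIntegrable (by fun_prop) _ _), intervalIntegral.integral_sub
      (Continuous.intervalIntegrable (by fun_prop) _ _)
      (Continuous.intervalIntegrable (by fun_prop) _ _), intervalIntegral.integral_const_mul,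
      intervalIntegral.integral_const_mul]
  have h := integral_sq_mul_le_of_mean_zero hab hp hp1 hp2 hp3 hlog
    (fun x => (hu x).sub_const m) hu' e1
  rw [e2] at h
  have hmP : ∫ x in a..b, u x * p x = m * P := by rw [hm]; field_simp
  have h' := mul_le_mul_of_nonneg_left h hP0.le
  rw [hmP] at h' ⊢
  nlinarith

end PayneWeinberger

/-! ### Log-concave marginals of convex sets -/

namespace PayneWeinberger

open Real Set Filter Topology

variable {m : ℕ}

theorem hasDerivAt_setIntegral_comp_sub {K : Set (Space m)} (hK : MeasurableSet K)
    (hKb : Bornology.IsBounded K) (e : Space m) {φ φ' : ℝ → ℝ}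
    (hφ : ∀ t, HasDerivAt φ (φ' t) t) (hφ' : Continuous φ') (t : ℝ) :
    HasDerivAt (fun t => ∫ x in K, φ (t - inner ℝ e x)) (∫ x in K, φ' (t - inner ℝ e x)) t := by
  have cφ : Continuous φ := continuous_iff_continuousAt.2 fun x => (hφ x).continuousAt
  have hfin : IsFiniteMeasure (volume.restrict K) :=
    ⟨by simpa using hKb.measure_lt_top⟩
  have hint : ∀ (ψ : ℝ → ℝ) (s : ℝ), Continuous ψ →
      IntegrableOn (fun x => ψ (s - inner ℝ e x)) K := fun ψ s hψ =>
    ((show Continuous fun x : Space m => ψ (s - inner ℝ e x) by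
      fun_prop).continuousOn.integrableOn_compact hKb.isCompact_closure).mono_set subset_closure
  have hc : IsCompact ((fun q : ℝ × Space m => q.1 - inner ℝ e q.2) ''
      (Metric.closedBall t 1 ×ˢ closure K)) :=
    ((isCompact_closedBall t 1).prod hKb.isCompact_closure).image (by fun_prop)
  obtain ⟨C, hC⟩ := hc.exists_bound_of_continuousOn hφ'.continuousOn
  refine (hasDerivAt_integral_of_dominated_loc_of_deriv_le (bound := fun _ => C)
    (F := fun t x => φ (t - inner ℝ e x)) (F' := fun t x => φ' (t - inner ℝ e x))
    (Metric.ball_mem_nhds t one_pos)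
    (Eventually.of_forall fun s => (hint φ s cφ).aestronglyMeasurable) (hint φ t cφ)
    (hint φ' t hφ').aestronglyMeasurable ?_ (integrable_const C) ?_).2
  · filter_upwards [ae_restrict_mem hK] with x hx s hs
    exact hC _ ⟨(s, x), ⟨Metric.ball_subset_closedBall hs, subset_closure hx⟩, rfl⟩
  · refine Eventually.of_forall fun x s _ => ?_
    exact (hφ (s - inner ℝ e x)).comp_sub_const s (inner ℝ e x)

/-- The marginal of the uniform measure on `K` in the direction `e`, mollified by a Gaussian. -/
noncomputable def marginal (K : Set (Space m)) (e : Space m) (n t : ℝ) : ℝ :=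
  ∫ x in K, exp (-(n * (t - inner ℝ e x)) ^ 2)

theorem integrableOn_gaussian {K : Set (Space m)} (hKb : Bornology.IsBounded K) (e : Space m)
    (n t : ℝ) : IntegrableOn (fun x => exp (-(n * (t - inner ℝ e x)) ^ 2)) K :=
  ((show Continuous fun x : Space m => exp (-(n * (t - inner ℝ e x)) ^ 2) by
    fun_prop).continuousOn.integrableOn_compact hKb.isCompact_closure).mono_set subset_closure

/-- Marginals of a convex set are log-concave, by the Prékopa–Leindler inequality. -/
theorem marginal_mul_le {K : Set (Space m)} (hK : Convex ℝ K) (hKo : IsOpen K)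
    (hKb : Bornology.IsBounded K) (e : Space m) (n s t : ℝ) :
    marginal K e n s * marginal K e n t ≤ marginal K e n ((s + t) / 2) ^ 2 := by
  let F : ℝ → Space m → ENNReal := fun t =>
    K.indicator fun x => ENNReal.ofReal (exp (-(n * (t - inner ℝ e x)) ^ 2))
  have hF : ∀ t, Measurable (F t) := fun t =>
    Measurable.indicator (Measurable.ennreal_ofReal
      (Continuous.measurable (by fun_prop))) hKo.measurableSet
  have hFi : ∀ t, ∫⁻ x, F t x = ENNReal.ofReal (marginal K e n t) := fun t => by
    rw [lintegral_indicator hKo.measurableSet, marginal,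
      ofReal_integral_eq_lintegral_ofReal (integrableOn_gaussian hKb e n t)
        (Eventually.of_forall fun x => (exp_pos _).le)]
  have hnn : ∀ t, 0 ≤ marginal K e n t := fun t => integral_nonneg fun x => (exp_pos _).le
  have := PrekopaLeindler.lintegral_mul_le (hF s) (hF t) (hF ((s + t) / 2)) fun x y => by
    by_cases hx : x ∈ K
    · by_cases hy : y ∈ K
      · have hxy : (2⁻¹ : ℝ) • (x + y) ∈ K := by
          rw [smul_add]
          exact hK hx hy (by norm_num) (by norm_num) (by norm_num)
        simp only [F, indicator_of_mem hx, indicator_of_mem hy, indicator_of_mem hxy]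
        rw [← ENNReal.ofReal_mul (exp_pos _).le, ← ENNReal.ofReal_pow (exp_pos _).le, ← exp_add,
          ← exp_nat_mul]
        refine ENNReal.ofReal_le_ofReal (exp_le_exp.2 ?_)
        rw [inner_smul_right, inner_add_right]
        push_cast
        nlinarith [sq_nonneg (n * (s - inner ℝ e x) - n * (t - inner ℝ e y))]
      · simp [F, indicator_of_notMem hy]
    · simp [F, indicator_of_notMem hx]
  rw [hFi, hFi, hFi, ← ENNReal.ofReal_mul (hnn s), ← ENNReal.ofReal_pow (hnn _)] at this
  exact (ENNReal.ofReal_le_ofReal_iff (sq_nonneg _)).1 this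

/-- The infinitesimal form of midpoint log-concavity: `h ↦ p (t + h) p (t - h)` has its maximum
at `0`. -/
theorem mul_deriv_le_of_mul_le {p p' p'' : ℝ → ℝ} (hp1 : ∀ x, HasDerivAt p (p' x) x)
    (hp2 : ∀ x, HasDerivAt p' (p'' x) x)
    (h : ∀ s t, p s * p t ≤ p ((s + t) / 2) ^ 2) (t : ℝ) : p t * p'' t ≤ p' t ^ 2 := by
  by_contra! hlt
  let φ : ℝ → ℝ := fun x => p (t + x) * p (t - x)
  let φ' : ℝ → ℝ := fun x => p' (t + x) * p (t - x) - p (t + x) * p' (t - x)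
  have add : ∀ {k k' : ℝ → ℝ}, (∀ x, HasDerivAt k (k' x) x) → ∀ x,
      HasDerivAt (fun x => k (t + x)) (k' (t + x)) x := fun hk x => by
    exact (hk (t + x)).comp_const_add t x
  have sub : ∀ {k k' : ℝ → ℝ}, (∀ x, HasDerivAt k (k' x) x) → ∀ x,
      HasDerivAt (fun x => k (t - x)) (-k' (t - x)) x := fun hk x => by
    exact (hk (t - x)).comp_const_sub t x
  have d1 : ∀ x, HasDerivAt φ (φ' x) x := fun x =>
    ((add hp1 x).mul (sub hp1 x)).congr_deriv (by simp only [φ']; ring)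
  have d2 : HasDerivAt φ' (2 * (p t * p'' t - p' t ^ 2)) 0 := by
    refine (((add hp2 0).mul (sub hp1 0)).sub ((add hp1 0).mul (sub hp2 0))).congr_deriv ?_
    simp only [add_zero, sub_zero]
    ring
  have hd : deriv φ = φ' := funext fun x => (d1 x).deriv
  have hmax : ∀ x, φ x ≤ φ 0 := fun x => by
    have := h (t + x) (t - x)
    simp only [φ, add_zero, sub_zero, ← sq]
    convert this using 3
    ring
  have hmin : IsLocalMin φ 0 := by
    refine isLocalMin_of_deriv_deriv_pos ?_ ?_ (d1 0).continuousAt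
    · rw [hd, d2.deriv]; linarith
    · rw [hd]; simp [φ', mul_comm]
  have hconst : φ =ᶠ[𝓝 0] fun _ => φ 0 := by
    filter_upwards [hmin] with x hx using le_antisymm (hmax x) hx
  have h2 := hconst.deriv.deriv_eq
  rw [hd, d2.deriv] at h2
  simp at h2
  linarith

theorem marginal_pos {K : Set (Space m)} (hKo : IsOpen K) (hKb : Bornology.IsBounded K)
    (hK0 : K.Nonempty) (e : Space m) (n t : ℝ) : 0 < marginal K e n t := by
  have : NeZero (volume.restrict K) := ⟨by
    rw [Ne, Measure.restrict_eq_zero]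
    exact (hKo.measure_pos volume hK0).ne'⟩
  exact integral_exp_pos (integrableOn_gaussian hKb e n t)

theorem marginal_deriv {K : Set (Space m)} (hK : Convex ℝ K) (hKo : IsOpen K)
    (hKb : Bornology.IsBounded K) (e : Space m) (n : ℝ) :
    ∃ p' p'' : ℝ → ℝ, (∀ t, HasDerivAt (marginal K e n) (p' t) t) ∧
      (∀ t, HasDerivAt p' (p'' t) t) ∧ Continuous p'' ∧
      ∀ t, marginal K e n t * p'' t ≤ p' t ^ 2 := by
  have key : ∀ (φ : ℝ → ℝ), ContDiff ℝ 1 φ → ∀ t,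
      HasDerivAt (fun t => ∫ x in K, φ (t - inner ℝ e x))
        (∫ x in K, deriv φ (t - inner ℝ e x)) t := fun φ hφ t =>
    hasDerivAt_setIntegral_comp_sub hKo.measurableSet hKb e
      (fun t => (hφ.differentiable one_ne_zero t).hasDerivAt) (hφ.continuous_deriv le_rfl) t
  let φ : ℝ → ℝ := fun t => exp (-(n * t) ^ 2)
  have h0 : ContDiff ℝ 3 φ := by fun_prop
  have h1 : ContDiff ℝ 2 (deriv φ) := ((contDiff_succ_iff_deriv (n := 2)).1 h0).2.2
  have h2 : ContDiff ℝ 1 (deriv (deriv φ)) := ((contDiff_succ_iff_deriv (n := 1)).1 h1).2.2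
  have d1 := key φ (h0.of_le (by norm_num))
  have d2 := key _ (h1.of_le (by norm_num))
  have d3 := key _ h2
  refine ⟨_, _, d1, d2, continuous_iff_continuousAt.2 fun t => (d3 t).continuousAt, fun t => ?_⟩
  exact mul_deriv_le_of_mul_le d1 d2 (marginal_mul_le hK hKo hKb e n) t

end PayneWeinberger

namespace PayneWeinberger

open Real Set Filter Topology

variable {m : ℕ}

/-- The Gaussian kernels `n/√π exp (-(n (y - t))²)` are an approximate identity at each interior
point of `(a, b)`. -/
theorem tendsto_gaussian_average {a b y : ℝ} (hy : y ∈ Ioo a b) {F : ℝ → ℝ} (hF : Continuous F) :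
    Tendsto (fun n : ℝ => n / √π * ∫ t in a..b, F t * exp (-(n * (t - y)) ^ 2)) atTop
      (𝓝 (F y)) := by
  have hab : a ≤ b := (hy.1.trans hy.2).le
  have hg : Integrable (indicator (Ioc a b) F) :=
    (integrable_indicator_iff measurableSet_Ioc).2
      (hF.integrableOn_Icc.mono_set Ioc_subset_Icc_self)
  have hga : ContinuousAt (indicator (Ioc a b) F) y := by
    refine hF.continuousAt.congr ?_
    filter_upwards [Ioo_mem_nhds hy.1 hy.2] with x hx
    rw [indicator_of_mem (Ioo_subset_Ioc_self hx)]
  have h1 : ∫ x : ℝ, (√π)⁻¹ * exp (-x ^ 2) = 1 := by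
    have := integral_gaussian 1
    simp only [neg_mul, one_mul, div_one] at this
    rw [integral_const_mul, this]
    exact inv_mul_cancel₀ (sqrt_pos.2 pi_pos).ne'
  have hdecay : Tendsto (fun x : ℝ => ‖x‖ ^ Module.finrank ℝ ℝ * ((√π)⁻¹ * exp (-x ^ 2)))
      (Bornology.cobounded ℝ) (𝓝 0) := by
    have := tendsto_rpow_abs_mul_exp_neg_mul_sq_cocompact (a := 1) one_pos 1
    simp only [rpow_one, neg_mul, one_mul] at this
    have := this.const_mul (√π)⁻¹
    rw [mul_zero] at this
    rw [Metric.cobounded_eq_cocompact]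
    refine this.congr fun x => ?_
    simp only [Module.finrank_self, pow_one, norm_eq_abs]
    ring
  have := tendsto_integral_comp_smul_smul_of_integrable' (μ := volume)
    (φ := fun x : ℝ => (√π)⁻¹ * exp (-x ^ 2)) (fun x => by positivity) h1 hdecay hg hga
  rw [indicator_of_mem (Ioo_subset_Ioc_self hy)] at this
  refine this.congr fun n => ?_
  rw [intervalIntegral.integral_of_le hab, ← integral_const_mul,
    ← integral_indicator measurableSet_Ioc]
  refine integral_congr_ae (Eventually.of_forall fun t => ?_)
  by_cases ht : t ∈ Ioc a b
  · simp only [indicator_of_mem ht, Module.finrank_self, pow_one, smul_eq_mul]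
    rw [show (n * (y - t)) ^ 2 = (n * (t - y)) ^ 2 by ring]
    ring
  · simp [indicator_of_notMem ht]

theorem abs_gaussian_average_le {a b y n C : ℝ} (hab : a ≤ b) (hn : 0 < n) {F : ℝ → ℝ}
    (hF : Continuous F) (hC : ∀ t ∈ Icc a b, |F t| ≤ C) :
    |n / √π * ∫ t in a..b, F t * exp (-(n * (t - y)) ^ 2)| ≤ C := by
  have hC0 : 0 ≤ C := (abs_nonneg _).trans (hC a (left_mem_Icc.2 hab))
  have hint : Integrable fun t : ℝ => exp (-(n * (t - y)) ^ 2) := by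
    have := (integrable_exp_neg_mul_sq (show 0 < n ^ 2 by positivity)).comp_sub_right y
    simpa [mul_pow] using this
  have htot : ∫ t : ℝ, exp (-(n * (t - y)) ^ 2) = √π / n := by
    have := integral_sub_right_eq_self (μ := volume) (fun t : ℝ => exp (-n ^ 2 * t ^ 2)) y
    rw [integral_gaussian, sqrt_div pi_pos.le, sqrt_sq hn.le] at this
    rw [← this]
    simp [mul_pow]
  have hsπ : 0 < √π := sqrt_pos.2 pi_pos
  have h1 : |∫ t in a..b, F t * exp (-(n * (t - y)) ^ 2)| ≤ C * (√π / n) := by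
    calc |∫ t in a..b, F t * exp (-(n * (t - y)) ^ 2)|
        ≤ ∫ t in a..b, |F t * exp (-(n * (t - y)) ^ 2)| :=
          intervalIntegral.abs_integral_le_integral_abs hab
      _ ≤ ∫ t in a..b, C * exp (-(n * (t - y)) ^ 2) := by
          refine intervalIntegral.integral_mono_on hab
            (Continuous.intervalIntegrable (by fun_prop) _ _)
            (Continuous.intervalIntegrable (by fun_prop) _ _) fun t ht => ?_
          rw [abs_mul, abs_exp]
          gcongr
          exact hC t ht
      _ = C * ∫ t in Ioc a b, exp (-(n * (t - y)) ^ 2) := by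
          rw [intervalIntegral.integral_const_mul, intervalIntegral.integral_of_le hab]
      _ ≤ C * (√π / n) := by
          rw [← htot]
          exact mul_le_mul_of_nonneg_left
            (setIntegral_le_integral hint (Eventually.of_forall fun x => (exp_pos _).le)) hC0
  rw [abs_mul, abs_of_pos (by positivity)]
  calc n / √π * |∫ t in a..b, F t * exp (-(n * (t - y)) ^ 2)|
      ≤ n / √π * (C * (√π / n)) := by gcongr
    _ = C := by field_simp

theorem integral_mul_marginal {K : Set (Space m)} (hKb : Bornology.IsBounded K) (e : Space m)
    {a b : ℝ} (hab : a ≤ b) {F : ℝ → ℝ} (hF : Continuous F) (n : ℝ) :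
    ∫ t in a..b, F t * marginal K e n t =
      ∫ x in K, ∫ t in a..b, F t * exp (-(n * (t - inner ℝ e x)) ^ 2) := by
  simp_rw [marginal, ← integral_const_mul, intervalIntegral.integral_of_le hab]
  refine integral_integral_swap (f := fun t x => F t * exp (-(n * (t - inner ℝ e x)) ^ 2)) ?_
  rw [Measure.prod_restrict]
  refine (ContinuousOn.integrableOn_compact (μ := volume.prod volume)
    (isCompact_Icc.prod hKb.isCompact_closure)
    (Continuous.continuousOn ?_)).mono_set (prod_mono Ioc_subset_Icc_self subset_closure)
  simp only [Function.uncurry_def]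
  fun_prop

theorem tendsto_integral_mul_marginal {K : Set (Space m)} (hKm : MeasurableSet K)
    (hKb : Bornology.IsBounded K) (e : Space m) {a b : ℝ} (hab : a ≤ b)
    (hKab : ∀ x ∈ K, inner ℝ e x ∈ Ioo a b) {F : ℝ → ℝ} (hF : Continuous F) :
    Tendsto (fun n : ℝ => n / √π * ∫ t in a..b, F t * marginal K e n t) atTop
      (𝓝 (∫ x in K, F (inner ℝ e x))) := by
  have hfin : IsFiniteMeasure (volume.restrict K) := ⟨by simpa using hKb.measure_lt_top⟩
  obtain ⟨C, hC⟩ := isCompact_Icc.exists_bound_of_continuousOn (s := Icc a b) hF.continuousOn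
  simp_rw [integral_mul_marginal hKb e hab hF, ← integral_const_mul]
  refine tendsto_integral_filter_of_dominated_convergence (fun _ => C) ?_ ?_
    (integrable_const C) ?_
  · refine Eventually.of_forall fun n => Continuous.aestronglyMeasurable ?_
    refine continuous_const.mul
      (intervalIntegral.continuous_parametric_intervalIntegral_of_continuous'
        (f := fun x t => F t * exp (-(n * (t - inner ℝ e x)) ^ 2)) ?_ a b)
    simp only [Function.uncurry_def]
    fun_prop
  · filter_upwards [eventually_gt_atTop 0] with n hn
    exact Eventually.of_forall fun x => abs_gaussian_average_le hab hn hF hC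
  · filter_upwards [ae_restrict_mem hKm] with x hx
    exact tendsto_gaussian_average (hKab x hx) hF

/-- The Payne–Weinberger inequality on a convex set for functions of one linear coordinate. -/
theorem ridge_inequality {K : Set (Space m)} (hK : Convex ℝ K) (hKo : IsOpen K)
    (hKb : Bornology.IsBounded K) (hK0 : K.Nonempty) (e : Space m) {a b : ℝ}
    (hKab : ∀ x ∈ K, inner ℝ e x ∈ Ioo a b) {w w' : ℝ → ℝ} (hw : ∀ t, HasDerivAt w (w' t) t)
    (hw' : Continuous w') :
    volume.real K * (∫ x in K, w (inner ℝ e x) ^ 2) - (∫ x in K, w (inner ℝ e x)) ^ 2 ≤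
      ((b - a) / π) ^ 2 * (volume.real K * ∫ x in K, w' (inner ℝ e x) ^ 2) := by
  have cw : Continuous w := continuous_iff_continuousAt.2 fun x => (hw x).continuousAt
  obtain ⟨x₀, hx₀⟩ := hK0
  have hab : a < b := (hKab x₀ hx₀).1.trans (hKab x₀ hx₀).2
  have T : ∀ F : ℝ → ℝ, Continuous F → _ := fun F hF =>
    tendsto_integral_mul_marginal hKo.measurableSet hKb e hab.le hKab hF
  have T1 := T (fun _ => 1) continuous_const
  have T2 := T (fun t => w t ^ 2) (cw.pow 2)
  have T3 := T w cw
  have T4 := T (fun t => w' t ^ 2) (hw'.pow 2)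
  simp only [one_mul, setIntegral_const, smul_eq_mul, mul_one] at T1
  refine le_of_tendsto_of_tendsto ((T1.mul T2).sub (T3.pow 2)) ((T1.mul T4).const_mul _) ?_
  refine Eventually.of_forall fun n => ?_
  obtain ⟨p', p'', h1, h2, h3, h4⟩ := marginal_deriv hK hKo hKb e n
  have := integral_mul_integral_sq_le hab (marginal_pos hKo hKb ⟨x₀, hx₀⟩ e n) h1 h2 h3 h4 hw hw'
  have := mul_le_mul_of_nonneg_left this (sq_nonneg (n / √π))
  simp only
  linarith

end PayneWeinberger

/-! ### Localization to needles -/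

namespace PayneWeinberger

open Real Set Filter Topology

variable {m : ℕ}

/-- The affine function whose zero set is the hyperplane through the codimension-two plane
`x i = r, x j = s` at angle `θ`. -/
noncomputable def tilt (i j : Fin m) (r s θ : ℝ) (x : Space m) : ℝ :=
  cos θ * (x i - r) + sin θ * (x j - s)

theorem volume_tilt_eq_zero {i j : Fin m} (hij : i ≠ j) (r s θ : ℝ) :
    volume {x : Space m | tilt i j r s θ x = 0} = 0 := by
  let f : Space m →ₗ[ℝ] ℝ :=
    cos θ • (EuclideanSpace.proj i : Space m →L[ℝ] ℝ).toLinearMap +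
      sin θ • (EuclideanSpace.proj j : Space m →L[ℝ] ℝ).toLinearMap
  have hf : ∀ x, f x = cos θ * x i + sin θ * x j := fun x => rfl
  let p : Space m := EuclideanSpace.single i r + EuclideanSpace.single j s
  have hset : {x : Space m | tilt i j r s θ x = 0} =
      (fun x => x + (-p)) ⁻¹' (LinearMap.ker f : Set (Space m)) := by
    ext x
    simp only [mem_ofPred_eq, mem_preimage, SetLike.mem_coe, LinearMap.mem_ker, hf, tilt, p]
    simp [hij, hij.symm, sub_eq_add_neg]
  rw [hset, measure_preimage_add_right]
  refine Measure.addHaar_submodule _ _ fun htop => ?_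
  have h : ∀ x, f x = 0 := fun x => by
    rw [← LinearMap.mem_ker, htop]; trivial
  have h1 := h (EuclideanSpace.single i 1)
  have h2 := h (EuclideanSpace.single j 1)
  rw [hf] at h1 h2
  simp [hij, hij.symm] at h1 h2
  have := sin_sq_add_cos_sq θ
  simp [h1, h2] at this

theorem continuous_tilt (i j : Fin m) (r s θ : ℝ) : Continuous (tilt i j r s θ) := by
  unfold tilt; fun_prop

theorem continuous_integral_tilt_pos {i j : Fin m} (hij : i ≠ j) (r s : ℝ) {K : Set (Space m)}
    {u : Space m → ℝ} (hu : IntegrableOn u K) :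
    Continuous fun θ => ∫ x in K, {x | 0 < tilt i j r s θ x}.indicator u x := by
  refine continuous_iff_continuousAt.2 fun θ₀ => ?_
  refine continuousAt_of_dominated (bound := fun x => ‖u x‖) ?_ ?_ hu.norm ?_
  · refine Eventually.of_forall fun θ => hu.aestronglyMeasurable.indicator ?_
    exact measurableSet_lt measurable_const (continuous_tilt i j r s θ).measurable
  · exact Eventually.of_forall fun θ => Eventually.of_forall fun x =>
      norm_indicator_le_norm_self _ _
  · have h0 : ∀ᵐ x ∂volume.restrict K, tilt i j r s θ₀ x ≠ 0 :=
      ae_restrict_of_ae (measure_eq_zero_iff_ae_notMem.1 (volume_tilt_eq_zero hij r s θ₀))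
    filter_upwards [h0] with x hx
    have hc : Continuous fun θ => tilt i j r s θ x := by unfold tilt; fun_prop
    rcases lt_or_gt_of_ne hx with h | h
    · refine (continuousAt_const (y := (0 : ℝ))).congr ?_
      filter_upwards [hc.continuousAt.eventually_lt continuousAt_const h] with θ hθ
      rw [indicator_of_notMem]
      simpa using hθ.le
    · refine (continuousAt_const (y := u x)).congr ?_
      filter_upwards [continuousAt_const.eventually_lt hc.continuousAt h] with θ hθ
      rw [indicator_of_mem]
      exact hθ

theorem convex_tilt_pos (i j : Fin m) (r s θ : ℝ) : Convex ℝ {x | 0 < tilt i j r s θ x} := by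
  intro x hx y hy a b ha hb hab
  have : tilt i j r s θ (a • x + b • y) = a * tilt i j r s θ x + b * tilt i j r s θ y := by
    simp only [tilt, PiLp.add_apply, PiLp.smul_apply, smul_eq_mul]
    linear_combination (cos θ * r + sin θ * s) * (hab)
  simp only [mem_ofPred_eq] at *
  rw [this]
  rcases ha.eq_or_lt with rfl | ha'
  · have : b = 1 := by linarith
    simp [this, hy]
  · have := mul_pos ha' hx
    have := mul_nonneg hb hy.le
    linarith

theorem setIntegral_tilt_add {i j : Fin m} (hij : i ≠ j) (r s θ : ℝ) {K : Set (Space m)}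
    {u : Space m → ℝ} (hu : IntegrableOn u K) :
    (∫ x in K ∩ {x | 0 < tilt i j r s θ x}, u x) +
      ∫ x in K ∩ {x | 0 < tilt i j r s (θ + π) x}, u x = ∫ x in K, u x := by
  have hm : ∀ θ, MeasurableSet {x : Space m | 0 < tilt i j r s θ x} := fun θ =>
    measurableSet_lt measurable_const (continuous_tilt i j r s θ).measurable
  rw [← integral_inter_add_sdiff (hm θ) hu]
  congr 1
  refine setIntegral_congr_set ?_
  have h0 : ∀ᵐ x : Space m, tilt i j r s θ x ≠ 0 :=
    measure_eq_zero_iff_ae_notMem.1 (volume_tilt_eq_zero hij r s θ)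
  filter_upwards [h0] with x hx
  have e : tilt i j r s (θ + π) x = -tilt i j r s θ x := by
    simp only [tilt, cos_add_pi, sin_add_pi]; ring
  refine propext (and_congr_right fun _ => ?_)
  change 0 < tilt i j r s (θ + π) x ↔ ¬ (0 < tilt i j r s θ x)
  rw [e, neg_pos, not_lt]
  exact ⟨le_of_lt, fun h => lt_of_le_of_ne h hx⟩

/-- The pieces of the bisection procedure. -/
structure IsPiece (u g : Space m → ℝ) (K : Set (Space m)) : Prop where
  isOpen : IsOpen K
  convex : Convex ℝ K
  bounded : Bornology.IsBounded K
  integral_eq_zero : ∫ x in K, u x = 0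
  integral_pos : 0 < ∫ x in K, g x

/-- Bisection: some hyperplane through a given plane of codimension two halves the integral of `u`,
by the intermediate value theorem. -/
theorem IsPiece.exists_half {u g : Space m → ℝ} (hu : Continuous u) (hg : Continuous g)
    {K : Set (Space m)} (hK : IsPiece u g K) {i j : Fin m} (hij : i ≠ j) (r s : ℝ) :
    ∃ K' ⊆ K, IsPiece u g K' ∧ ∃ θ, ∀ x ∈ K', 0 < tilt i j r s θ x := by
  have hint : ∀ v : Space m → ℝ, Continuous v → IntegrableOn v K := fun v hv =>
    (hv.continuousOn.integrableOn_compact hK.bounded.isCompact_closure).mono_set subset_closure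
  have hm : ∀ θ, MeasurableSet {x : Space m | 0 < tilt i j r s θ x} := fun θ =>
    measurableSet_lt measurable_const (continuous_tilt i j r s θ).measurable
  let F : ℝ → ℝ := fun θ => ∫ x in K ∩ {x | 0 < tilt i j r s θ x}, u x
  have hF : Continuous F := by
    have := continuous_integral_tilt_pos hij r s (hint u hu)
    simpa only [setIntegral_indicator (hm _)] using this
  have hanti : ∀ θ, F θ + F (θ + π) = 0 := fun θ =>
    (setIntegral_tilt_add hij r s θ (hint u hu)).trans hK.integral_eq_zero
  obtain ⟨θ, hθ⟩ : ∃ θ, F θ = 0 := by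
    have h := hanti 0
    rcases le_total (F 0) 0 with h0 | h0
    · exact mem_range_of_exists_le_of_exists_ge hF ⟨0, h0⟩ ⟨0 + π, by linarith⟩
    · exact mem_range_of_exists_le_of_exists_ge hF ⟨0 + π, by linarith⟩ ⟨0, h0⟩
  have hθ' : F (θ + π) = 0 := by linarith [hanti θ]
  have half : ∀ θ, F θ = 0 → 0 < ∫ x in K ∩ {x | 0 < tilt i j r s θ x}, g x →
      ∃ K' ⊆ K, IsPiece u g K' ∧ ∃ θ, ∀ x ∈ K', 0 < tilt i j r s θ x := fun θ h1 h2 =>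
    ⟨K ∩ {x | 0 < tilt i j r s θ x}, inter_subset_left,
      ⟨hK.isOpen.inter (isOpen_lt continuous_const (continuous_tilt i j r s θ)),
        hK.convex.inter (convex_tilt_pos i j r s θ), hK.bounded.subset inter_subset_left, h1, h2⟩,
      θ, fun x hx => hx.2⟩
  have hsum := setIntegral_tilt_add hij r s θ (hint g hg)
  have hpos := hK.integral_pos
  rcases lt_or_ge 0 (∫ x in K ∩ {x | 0 < tilt i j r s θ x}, g x) with h | h
  · exact half θ hθ h
  · exact half (θ + π) hθ' (by linarith)

/-- Bisecting through all planes `x i = r, x j = s` with rational `r, s` in turn gives a decreasing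
sequence of pieces. -/
theorem IsPiece.exists_seq {u g : Space m → ℝ} (hu : Continuous u) (hg : Continuous g)
    {K : Set (Space m)} (hK : IsPiece u g K) :
    ∃ S : ℕ → Set (Space m), S 0 = K ∧ Antitone S ∧ (∀ n, IsPiece u g (S n)) ∧
      ∀ (i j : Fin m) (r s : ℚ), i ≠ j → ∃ n θ, ∀ x ∈ S n, 0 < tilt i j r s θ x := by
  rcases isEmpty_or_nonempty (Fin m) with hm | hm
  · exact ⟨fun _ => K, rfl, antitone_const, fun _ => hK, fun i => hm.elim i⟩
  have step : ∀ (L : {L : Set (Space m) // IsPiece u g L}) (q : Fin m × Fin m × ℚ × ℚ),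
      ∃ L' : {L : Set (Space m) // IsPiece u g L}, L'.1 ⊆ L.1 ∧
        (q.1 ≠ q.2.1 → ∃ θ, ∀ x ∈ L'.1, 0 < tilt q.1 q.2.1 q.2.2.1 q.2.2.2 θ x) := by
    rintro ⟨L, hL⟩ ⟨i, j, r, s⟩
    by_cases hij : i = j
    · exact ⟨⟨L, hL⟩, subset_rfl, fun h => (h hij).elim⟩
    · obtain ⟨L', h1, h2, h3⟩ := hL.exists_half hu hg hij r s
      exact ⟨⟨L', h2⟩, h1, fun _ => h3⟩
  choose next hsub hnext using step
  obtain ⟨enum, henum⟩ := exists_surjective_nat (Fin m × Fin m × ℚ × ℚ)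
  let S : ℕ → {L : Set (Space m) // IsPiece u g L} := fun n =>
    Nat.rec ⟨K, hK⟩ (fun n L => next L (enum n)) n
  refine ⟨fun n => (S n).1, rfl, antitone_nat_of_succ_le fun n => hsub (S n) (enum n),
    fun n => (S n).2, fun i j r s hij => ?_⟩
  obtain ⟨n, hn⟩ := henum (i, j, r, s)
  have := hnext (S n) (enum n)
  rw [hn] at this
  obtain ⟨θ, hθ⟩ := this hij
  refine ⟨n + 1, θ, ?_⟩
  change ∀ x ∈ (next (S n) (enum n)).1, _
  rw [hn]
  exact hθ

end PayneWeinberger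

namespace PayneWeinberger

open Real Set Filter Topology

variable {m : ℕ}

/-- A nondegenerate triangle contains a rational point in its interior. -/
theorem exists_rat_mem_triangle {x₁ x₂ y₁ y₂ z₁ z₂ : ℝ}
    (hD : (y₁ - x₁) * (z₂ - x₂) - (y₂ - x₂) * (z₁ - x₁) ≠ 0) :
    ∃ (r s : ℚ) (β γ : ℝ), 0 < β ∧ 0 < γ ∧ 0 < 1 - β - γ ∧
      (r : ℝ) = x₁ + β * (y₁ - x₁) + γ * (z₁ - x₁) ∧
      (s : ℝ) = x₂ + β * (y₂ - x₂) + γ * (z₂ - x₂) := by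
  set D := (y₁ - x₁) * (z₂ - x₂) - (y₂ - x₂) * (z₁ - x₁) with hDdef
  -- barycentric coordinates, by Cramer's rule
  let B : ℝ × ℝ → ℝ := fun p => ((p.1 - x₁) * (z₂ - x₂) - (p.2 - x₂) * (z₁ - x₁)) / D
  let C : ℝ × ℝ → ℝ := fun p => ((y₁ - x₁) * (p.2 - x₂) - (y₂ - x₂) * (p.1 - x₁)) / D
  have hB : Continuous B := by fun_prop
  have hC : Continuous C := by fun_prop
  let U : Set (ℝ × ℝ) := {p | 0 < B p} ∩ {p | 0 < C p} ∩ {p | 0 < 1 - B p - C p}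
  have hU : IsOpen U := ((isOpen_lt continuous_const hB).inter (isOpen_lt continuous_const hC)).inter
    (isOpen_lt continuous_const ((continuous_const.sub hB).sub hC))
  have hne : U.Nonempty := by
    refine ⟨((x₁ + y₁ + z₁) / 3, (x₂ + y₂ + z₂) / 3), ?_⟩
    have e1 : B ((x₁ + y₁ + z₁) / 3, (x₂ + y₂ + z₂) / 3) = 1 / 3 := by
      simp only [B]
      rw [div_eq_iff hD, hDdef]
      ring
    have e2 : C ((x₁ + y₁ + z₁) / 3, (x₂ + y₂ + z₂) / 3) = 1 / 3 := by
      simp only [C]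
      rw [div_eq_iff hD, hDdef]
      ring
    refine ⟨⟨?_, ?_⟩, ?_⟩ <;> simp only [mem_ofPred_eq, e1, e2] <;> norm_num
  obtain ⟨⟨r, s⟩, h⟩ := ((Rat.denseRange_cast (𝕜 := ℝ)).prodMap
    (Rat.denseRange_cast (𝕜 := ℝ))).exists_mem_open hU hne
  refine ⟨r, s, _, _, h.1.1, h.1.2, h.2, ?_, ?_⟩
  · simp only [B, C, Prod.map]
    field_simp
    rw [hDdef]
    ring
  · simp only [B, C, Prod.map]
    field_simp
    rw [hDdef]
    ring

/-- If every rational coordinate plane of codimension two lies on a hyperplane that does not separate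
`C`, then the projections of `C` to the coordinate planes are collinear: otherwise some rational
point would lie inside a projected triangle. -/
theorem det_eq_zero_of_tilt_nonneg {C : Set (Space m)}
    (hC : ∀ (i j : Fin m) (r s : ℚ), i ≠ j → ∃ θ, ∀ x ∈ C, 0 ≤ tilt i j r s θ x)
    {x y z : Space m} (hx : x ∈ C) (hy : y ∈ C) (hz : z ∈ C) {i j : Fin m} (hij : i ≠ j) :
    (y i - x i) * (z j - x j) = (y j - x j) * (z i - x i) := by
  by_contra hD
  obtain ⟨r, s, β, γ, hβ, hγ, hα, hr, hs⟩ := exists_rat_mem_triangle (sub_ne_zero.2 hD)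
  obtain ⟨θ, hθ⟩ := hC i j r s hij
  have h1 := hθ x hx
  have h2 := hθ y hy
  have h3 := hθ z hz
  have hsum : (1 - β - γ) * tilt i j r s θ x + β * tilt i j r s θ y + γ * tilt i j r s θ z = 0 := by
    simp only [tilt]
    rw [hr, hs]
    ring
  have e1 : tilt i j r s θ x = 0 := by
    nlinarith [mul_nonneg hα.le h1, mul_nonneg hβ.le h2, mul_nonneg hγ.le h3]
  have e2 : tilt i j r s θ y = 0 := by
    nlinarith [mul_nonneg hα.le h1, mul_nonneg hβ.le h2, mul_nonneg hγ.le h3]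
  have e3 : tilt i j r s θ z = 0 := by
    nlinarith [mul_nonneg hα.le h1, mul_nonneg hβ.le h2, mul_nonneg hγ.le h3]
  simp only [tilt] at e1 e2 e3
  have hne := sub_ne_zero.2 hD
  have hcos : cos θ = 0 := by
    have : cos θ * ((y i - x i) * (z j - x j) - (y j - x j) * (z i - x i)) = 0 := by
      linear_combination (e2 - e1) * (z j - x j) - (e3 - e1) * (y j - x j)
    exact (mul_eq_zero.1 this).resolve_right hne
  have hsin : sin θ = 0 := by
    have : sin θ * ((y i - x i) * (z j - x j) - (y j - x j) * (z i - x i)) = 0 := by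
      linear_combination (e3 - e1) * (y i - x i) - (e2 - e1) * (z i - x i)
    exact (mul_eq_zero.1 this).resolve_right hne
  have := sin_sq_add_cos_sq θ
  simp [hcos, hsin] at this

theorem exists_line_of_det_eq_zero [Nonempty (Fin m)] {C : Set (Space m)}
    (hC : ∀ x ∈ C, ∀ y ∈ C, ∀ z ∈ C, ∀ i j : Fin m, i ≠ j →
      (y i - x i) * (z j - x j) = (y j - x j) * (z i - x i)) :
    ∃ p e : Space m, ‖e‖ = 1 ∧ ∀ x ∈ C, ∃ c : ℝ, x - p = c • e := by
  by_cases hs : C.Subsingleton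
  · obtain ⟨e, he⟩ := exists_norm_eq (Space m) zero_le_one
    rcases hs.eq_empty_or_singleton with rfl | ⟨p, rfl⟩
    · exact ⟨0, e, he, by simp⟩
    · exact ⟨p, e, he, fun x hx => ⟨0, by rw [mem_singleton_iff.1 hx]; simp⟩⟩
  · obtain ⟨p, hp, q, hq, hpq⟩ := not_subsingleton_iff.1 hs
    have hn : ‖q - p‖ ≠ 0 := by simpa [sub_eq_zero] using hpq.symm
    obtain ⟨i, hi⟩ : ∃ i, q i ≠ p i := by
      by_contra! h
      exact hpq.symm (by ext i; exact h i)
    have hi' := sub_ne_zero.2 hi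
    refine ⟨p, ‖q - p‖⁻¹ • (q - p), by rw [norm_smul, norm_inv, norm_norm]; field_simp,
      fun x hx => ⟨(x i - p i) / (q i - p i) * ‖q - p‖, ?_⟩⟩
    rw [smul_smul, mul_assoc, mul_inv_cancel₀ hn, mul_one]
    ext j
    simp only [PiLp.sub_apply, PiLp.smul_apply, smul_eq_mul]
    by_cases hij : i = j
    · subst hij
      field_simp
    · have := hC p hp q hq x hx i j hij
      field_simp
      linear_combination this

/-- Localization: some piece lies in an arbitrarily thin tube around a line. -/
theorem IsPiece.exists_needle [Nonempty (Fin m)] {u g : Space m → ℝ} (hu : Continuous u)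
    (hg : Continuous g) {K : Set (Space m)} (hK : IsPiece u g K) {δ : ℝ} (hδ : 0 < δ) :
    ∃ K' ⊆ K, IsPiece u g K' ∧ ∃ p e : Space m, ‖e‖ = 1 ∧
      ∀ x ∈ K', ‖x - (p + (inner ℝ e (x - p) : ℝ) • e)‖ < δ := by
  obtain ⟨S, hS0, hSanti, hS, hStilt⟩ := hK.exists_seq hu hg
  have hdet := fun {x y z : Space m} => det_eq_zero_of_tilt_nonneg (C := ⋂ n, closure (S n))
    (x := x) (y := y) (z := z) fun i j r s hij => by
      obtain ⟨n, θ, hθ⟩ := hStilt i j r s hij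
      refine ⟨θ, fun x hx => ?_⟩
      have hcl : closure (S n) ⊆ {x | 0 ≤ tilt i j r s θ x} :=
        closure_minimal (fun x hx => (hθ x hx).le)
          (isClosed_le continuous_const (continuous_tilt i j r s θ))
      exact hcl (mem_iInter.1 hx n)
  obtain ⟨p, e, he, hline⟩ := exists_line_of_det_eq_zero (C := ⋂ n, closure (S n))
    fun x hx y hy z hz i j hij => hdet hx hy hz hij
  have hU : IsOpen {x : Space m | ‖x - (p + (inner ℝ e (x - p) : ℝ) • e)‖ < δ} :=
    isOpen_lt (by fun_prop) continuous_const
  obtain ⟨n, hn⟩ := exists_subset_nhds_of_isCompact (V := fun n => closure (S n))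
    (directed_of_isDirected_le fun a b hab => closure_mono (hSanti hab))
    (fun n => (hS n).bounded.isCompact_closure)
    (U := {x | ‖x - (p + (inner ℝ e (x - p) : ℝ) • e)‖ < δ})
    fun x hx => hU.mem_nhds (by
      obtain ⟨c, hc⟩ := hline x hx
      have : x - (p + (inner ℝ e (x - p) : ℝ) • e) = 0 := by
        rw [← sub_sub, hc, inner_smul_right, real_inner_self_eq_norm_sq, he]
        simp
      simp [this, hδ])
  exact ⟨S n, hS0 ▸ hSanti (Nat.zero_le n), hS n, p, e, he, fun x hx => hn (subset_closure hx)⟩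

/-- A bounded open set projects in a unit direction into an open interval no longer than its
diameter. -/
theorem exists_projection_interval {K : Set (Space m)} (hKo : IsOpen K)
    (hKb : Bornology.IsBounded K) (hK0 : K.Nonempty) {e : Space m} (he : ‖e‖ = 1) :
    ∃ a b : ℝ, (∀ x ∈ K, inner ℝ e x ∈ Ioo a b) ∧ b - a ≤ Metric.diam K := by
  let ℓ : Space m → ℝ := fun x => inner ℝ e x
  have hlip : ∀ x y, ℓ x - ℓ y ≤ dist x y := fun x y => by
    rw [← inner_sub_right, dist_eq_norm]
    simpa [he] using real_inner_le_norm e (x - y)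
  obtain ⟨x₀, hx₀⟩ := hK0
  have hbd : Bornology.IsBounded (ℓ '' K) := by
    have : LipschitzWith 1 ℓ := LipschitzWith.of_le_add fun x y => by linarith [hlip x y]
    exact this.isBounded_image hKb
  have hne : (ℓ '' K).Nonempty := ⟨_, x₀, hx₀, rfl⟩
  refine ⟨sInf (ℓ '' K), sSup (ℓ '' K), fun x hx => ?_, ?_⟩
  · obtain ⟨ε, hε, hball⟩ := Metric.isOpen_iff.1 hKo x hx
    have key : ∀ s : ℝ, |s| = ε / 2 → ℓ x + s ∈ ℓ '' K := fun s hs => by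
      refine ⟨x + s • e, hball ?_, ?_⟩
      · rw [Metric.mem_ball, dist_eq_norm, add_sub_cancel_left, norm_smul, he, norm_eq_abs, hs]
        linarith
      · simp only [ℓ]
        rw [inner_add_right, inner_smul_right, real_inner_self_eq_norm_sq, he]
        ring
    have h1 := csInf_le hbd.bddBelow (key (-(ε / 2)) (by rw [abs_neg, abs_of_pos (by linarith)]))
    have h2 := le_csSup hbd.bddAbove (key (ε / 2) (abs_of_pos (by linarith)))
    simp only [ℓ] at *
    exact ⟨by linarith, by linarith⟩
  · have : ∀ y ∈ ℓ '' K, y ≤ sInf (ℓ '' K) + Metric.diam K := by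
      rintro _ ⟨x, hx, rfl⟩
      rw [← sub_le_iff_le_add]
      refine le_csInf hne ?_
      rintro _ ⟨y, hy, rfl⟩
      linarith [hlip x y, Metric.dist_le_diam_of_mem hKb hx hy]
    linarith [csSup_le hne this]

end PayneWeinberger

/-! ### The Payne–Weinberger inequality -/

namespace PayneWeinberger

open Real Set Filter Topology

variable {m : ℕ}

theorem continuous_gradient {φ : Space m → ℝ} (hφ : ContDiff ℝ 1 φ) : Continuous (gradient φ) :=
  (InnerProductSpace.toDual ℝ (Space m)).symm.continuous.comp (hφ.continuous_fderiv one_ne_zero)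

theorem hasCompactSupport_gradient {φ : Space m → ℝ} (hφ : HasCompactSupport φ) :
    HasCompactSupport (gradient φ) :=
  (hφ.fderiv (𝕜 := ℝ)).comp_left (map_zero (InnerProductSpace.toDual ℝ (Space m)).symm)

theorem integrableOn_of_continuous {K : Set (Space m)} (hKb : Bornology.IsBounded K)
    {v : Space m → ℝ} (hv : Continuous v) : IntegrableOn v K :=
  (hv.continuousOn.integrableOn_compact hKb.isCompact_closure).mono_set subset_closure

/-- On a needle, a function differs little from its restriction to the axis, for which the
one-dimensional inequality holds. -/
theorem integral_sub_le_of_needle {K : Set (Space m)} (hK : Convex ℝ K) (hKo : IsOpen K)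
    (hKb : Bornology.IsBounded K) (hK0 : K.Nonempty) {e p : Space m} (he : ‖e‖ = 1)
    {φ : Space m → ℝ} (hφ : ContDiff ℝ 1 φ) (hmean : ∫ x in K, φ x = 0) {d ε M : ℝ}
    (hd : Metric.diam K ≤ d) (hε : 0 ≤ ε) (hM : ∀ x, |φ x| ≤ M)
    (h1 : ∀ x ∈ K, |φ x - φ (p + (inner ℝ e (x - p) : ℝ) • e)| ≤ ε)
    (h2 : ∀ x ∈ K, ‖gradient φ (p + (inner ℝ e (x - p) : ℝ) • e)‖ ^ 2 ≤ ‖gradient φ x‖ ^ 2 + ε) :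
    ∫ x in K, (φ x ^ 2 - (d / π) ^ 2 * ‖gradient φ x‖ ^ 2) ≤
      (ε ^ 2 + 2 * M * ε + (d / π) ^ 2 * ε) * volume.real K := by
  have hd0 : 0 ≤ d := Metric.diam_nonneg.trans hd
  have cφ : Continuous φ := hφ.continuous
  have cg : Continuous (gradient φ) := continuous_gradient hφ
  have hKfin : volume K ≠ ⊤ := hKb.measure_lt_top.ne
  have hV : 0 < volume.real K :=
    ENNReal.toReal_pos (hKo.measure_pos volume hK0).ne' hKfin
  set V := volume.real K with hVdef
  obtain ⟨a, b, hab, hba⟩ := exists_projection_interval hKo hKb hK0 he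
  have hab' : 0 ≤ b - a := by
    obtain ⟨x, hx⟩ := hK0
    linarith [(hab x hx).1, (hab x hx).2]
  let P : ℝ → Space m := fun t => p + (t - inner ℝ e p) • e
  let w : ℝ → ℝ := fun t => φ (P t)
  let w' : ℝ → ℝ := fun t => inner ℝ (gradient φ (P t)) e
  have cP : Continuous P := by fun_prop
  have hP : ∀ x, P (inner ℝ e x) = p + (inner ℝ e (x - p) : ℝ) • e := fun x => by
    simp only [P, inner_sub_right]
  have hw : ∀ t, HasDerivAt w (w' t) t := fun t => by
    have hP' : HasDerivAt P e t :=
      ((((hasDerivAt_id t).sub_const (inner ℝ e p)).smul_const e).const_add p).congr_deriv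
        (one_smul ℝ e)
    have hg := ((hφ.differentiable one_ne_zero) (P t)).hasGradientAt.hasFDerivAt
    exact hg.comp_hasDerivAt t hP'
  have cw' : Continuous w' := (cg.comp cP).inner continuous_const
  have ridge := ridge_inequality hK hKo hKb hK0 e hab hw cw'
  have cℓ : Continuous fun x : Space m => (inner ℝ e x : ℝ) := by fun_prop
  have cw : Continuous fun x : Space m => w (inner ℝ e x) := cφ.comp (cP.comp cℓ)
  have cw'2 : Continuous fun x : Space m => w' (inner ℝ e x) ^ 2 := (cw'.comp cℓ).pow 2
  have cw2 : Continuous fun x : Space m => w (inner ℝ e x) ^ 2 := cw.pow 2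
  have cφ2 : Continuous fun x => φ x ^ 2 := cφ.pow 2
  have cg2 : Continuous fun x => ‖gradient φ x‖ ^ 2 := cg.norm.pow 2
  have ii : ∀ {v : Space m → ℝ}, Continuous v → IntegrableOn v K := fun hv =>
    integrableOn_of_continuous hKb hv
  have iconst : ∀ c : ℝ, ∫ x in K, c = c * V := fun c => by
    rw [setIntegral_const, smul_eq_mul, mul_comm]
  set I1 := ∫ x in K, w (inner ℝ e x) with hI1
  set I2 := ∫ x in K, w (inner ℝ e x) ^ 2 with hI2
  set I3 := ∫ x in K, w' (inner ℝ e x) ^ 2 with hI3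
  have b1 : |I1| ≤ ε * V := by
    have : I1 = ∫ x in K, (w (inner ℝ e x) - φ x) := by
      rw [integral_sub (ii cw) (ii cφ), hmean, sub_zero]
    rw [this, ← norm_eq_abs]
    refine norm_setIntegral_le_of_norm_le_const hKfin.lt_top fun x hx => ?_
    rw [norm_eq_abs, abs_sub_comm]
    simp only [w, hP]
    exact h1 x hx
  have b2 : ∫ x in K, φ x ^ 2 ≤ I2 + 2 * M * ε * V := by
    rw [← iconst, hI2, ← integral_add (ii cw2) (ii continuous_const)]
    refine setIntegral_mono_on (ii cφ2) (ii (cw2.add continuous_const))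
      hKo.measurableSet fun x hx => ?_
    have e1 := h1 x hx
    rw [← hP] at e1
    have e2 := abs_le.1 (hM x)
    have e3 := abs_le.1 (hM (P (inner ℝ e x)))
    have e4 : |(φ x - φ (P (inner ℝ e x))) * (φ x + φ (P (inner ℝ e x)))| ≤ ε * (2 * M) := by
      rw [abs_mul]
      refine mul_le_mul e1 (abs_le.2 ⟨by linarith, by linarith⟩) (abs_nonneg _) hε
    have e5 := (abs_le.1 e4).2
    simp only [w]
    linarith
  have b3 : I3 ≤ (∫ x in K, ‖gradient φ x‖ ^ 2) + ε * V := by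
    rw [← iconst, hI3, ← integral_add (ii cg2) (ii continuous_const)]
    refine setIntegral_mono_on (ii cw'2) (ii (cg2.add continuous_const))
      hKo.measurableSet fun x hx => ?_
    refine le_trans ?_ (h2 x hx)
    rw [← hP]
    have := abs_real_inner_le_norm (gradient φ (P (inner ℝ e x))) e
    rw [he, mul_one] at this
    exact sq_le_sq' (by linarith [(abs_le.1 this).1]) (abs_le.1 this).2
  have b4 : V * I2 - I1 ^ 2 ≤ (d / π) ^ 2 * (V * I3) := by
    refine ridge.trans (mul_le_mul_of_nonneg_right ?_ (mul_nonneg hV.le ?_))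
    · have := pi_pos
      have := hba.trans hd
      gcongr
    · exact integral_nonneg fun x => sq_nonneg _
  have b5 : I1 ^ 2 ≤ (ε * V) ^ 2 := sq_le_sq' (abs_le.1 b1).1 (abs_le.1 b1).2
  rw [integral_sub (ii cφ2) (ii (cg2.const_mul _)), integral_const_mul]
  set J := ∫ x in K, ‖gradient φ x‖ ^ 2 with hJ
  have b6 : I2 ≤ ε ^ 2 * V + (d / π) ^ 2 * I3 := by
    refine le_of_mul_le_mul_left ?_ hV
    nlinarith
  have b7 := mul_le_mul_of_nonneg_left b3 (sq_nonneg (d / π))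
  linarith

/-- The Payne–Weinberger inequality: on a convex set of diameter `d`, the Poincaré inequality for
functions with mean value zero holds with the constant `d / π`, in any dimension. -/
theorem integral_sq_le_of_integral_eq_zero {K : Set (Space m)} (hK : Convex ℝ K) (hKo : IsOpen K)
    (hKb : Bornology.IsBounded K) {φ : Space m → ℝ} (hφ : ContDiff ℝ 1 φ)
    {M : ℝ} (hM : ∀ x, |φ x| ≤ M) (uφ : UniformContinuous φ)
    (ug : UniformContinuous fun x => ‖gradient φ x‖ ^ 2) (hmean : ∫ x in K, φ x = 0) :
    ∫ x in K, φ x ^ 2 ≤ (Metric.diam K / π) ^ 2 * ∫ x in K, ‖gradient φ x‖ ^ 2 := by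
  have cφ : Continuous φ := hφ.continuous
  have cg : Continuous (gradient φ) := continuous_gradient hφ
  have cφ2 : Continuous fun x => φ x ^ 2 := cφ.pow 2
  have cg2 : Continuous fun x => ‖gradient φ x‖ ^ 2 := cg.norm.pow 2
  have ii : ∀ {v : Space m → ℝ}, Continuous v → IntegrableOn v K := fun hv =>
    integrableOn_of_continuous hKb hv
  set c := (Metric.diam K / π) ^ 2 with hc
  have hc0 : 0 ≤ c := sq_nonneg _
  rcases isEmpty_or_nonempty (Fin m) with hm | hm
  · -- in dimension zero `φ` is constant
    have hconst : ∀ x, φ x = φ 0 := fun x => congrArg φ (Subsingleton.elim _ _)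
    have h0 : ∫ x in K, φ x ^ 2 = φ 0 * ∫ x in K, φ x := by
      rw [← integral_const_mul]
      refine integral_congr_ae (Eventually.of_forall fun x => ?_)
      simp only [hconst x, sq]
    rw [h0, hmean, mul_zero]
    exact mul_nonneg hc0 (integral_nonneg fun x => sq_nonneg _)
  by_contra! hlt
  -- the failure has a margin `η` per unit volume, which localization preserves and which exceeds the
  -- error on a needle on which `φ` and its gradient vary by at most `ε` across
  set V := volume.real K with hV
  have hV0 : 0 ≤ V := measureReal_nonneg
  set gap := (∫ x in K, φ x ^ 2) - c * ∫ x in K, ‖gradient φ x‖ ^ 2 with hgap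
  have hgap0 : 0 < gap := sub_pos.2 hlt
  set η := gap / (2 * (V + 1)) with hη
  have hη0 : 0 < η := by positivity
  have hM0 : 0 ≤ M := (abs_nonneg _).trans (hM 0)
  set ε := min 1 (η / (1 + 2 * M + c)) with hε
  have hε0 : 0 < ε := by positivity
  have hεη : ε ^ 2 + 2 * M * ε + c * ε ≤ η := by
    have h1 : ε ≤ 1 := min_le_left _ _
    have h2 : ε * (1 + 2 * M + c) ≤ η := (le_div_iff₀ (by positivity)).1 (min_le_right _ _)
    nlinarith
  obtain ⟨δ₁, hδ₁, h1⟩ := Metric.uniformContinuous_iff.1 uφ ε hε0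
  obtain ⟨δ₂, hδ₂, h2⟩ := Metric.uniformContinuous_iff.1 ug ε hε0
  let g : Space m → ℝ := fun x => φ x ^ 2 - c * ‖gradient φ x‖ ^ 2 - η
  have cg0 : Continuous fun x => φ x ^ 2 - c * ‖gradient φ x‖ ^ 2 := by fun_prop
  have hgint : ∀ L : Set (Space m), Bornology.IsBounded L →
      ∫ x in L, g x = (∫ x in L, (φ x ^ 2 - c * ‖gradient φ x‖ ^ 2)) - η * volume.real L :=
    fun L hL => by
      rw [integral_sub (integrableOn_of_continuous hL cg0)
        (integrableOn_of_continuous hL continuous_const), setIntegral_const, smul_eq_mul, mul_comm]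
  have hpiece : IsPiece φ g K := by
    refine ⟨hKo, hK, hKb, hmean, ?_⟩
    rw [hgint K hKb, integral_sub (ii cφ2) (ii (cg2.const_mul c)),
      integral_const_mul, ← hgap, ← hV, hη, sub_pos, div_mul_eq_mul_div, div_lt_iff₀ (by positivity)]
    nlinarith
  obtain ⟨L, hLK, hL, p, e, he, htube⟩ :=
    hpiece.exists_needle cφ (show Continuous g from cg0.sub continuous_const) (lt_min hδ₁ hδ₂)
  have hL0 : L.Nonempty := by
    rw [nonempty_iff_ne_empty]
    rintro rfl
    have := hL.integral_pos
    simp at this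
  have hdist : ∀ x ∈ L, dist x (p + (inner ℝ e (x - p) : ℝ) • e) < min δ₁ δ₂ := fun x hx => by
    rw [dist_eq_norm]; exact htube x hx
  have needle := integral_sub_le_of_needle hL.convex hL.isOpen hL.bounded hL0 (p := p) he hφ
    hL.integral_eq_zero (Metric.diam_mono hLK hKb) hε0.le hM
    (fun x hx => (h1 ((hdist x hx).trans_le (min_le_left _ _))).le)
    (fun x hx => by
      have := (abs_le.1 (h2 ((hdist x hx).trans_le (min_le_right _ _))).le).1
      linarith)
  have hpos := hL.integral_pos
  rw [hgint L hL.bounded] at hpos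
  have : (ε ^ 2 + 2 * M * ε + c * ε) * volume.real L ≤ η * volume.real L :=
    mul_le_mul_of_nonneg_right hεη measureReal_nonneg
  linarith

/-- The Payne–Weinberger inequality for the restriction of a compactly supported function. -/
theorem exists_integral_sub_sq_le {K : Set (Space m)} (hK : Convex ℝ K) (hKo : IsOpen K)
    (hKb : Bornology.IsBounded K) {φ : Space m → ℝ} (hφ : ContDiff ℝ 1 φ)
    (hφc : HasCompactSupport φ) :
    ∃ c : ℝ, ∫ x in K, (φ x - c) ^ 2 ≤
      (Metric.diam K / π) ^ 2 * ∫ x in K, ‖gradient φ x‖ ^ 2 := by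
  rcases K.eq_empty_or_nonempty with rfl | hK0
  · exact ⟨0, by simp⟩
  have hV : 0 < volume.real K :=
    ENNReal.toReal_pos (hKo.measure_pos volume hK0).ne' hKb.measure_lt_top.ne
  obtain ⟨M, hM⟩ := hφc.exists_bound_of_continuous hφ.continuous
  have cg : Continuous fun x => ‖gradient φ x‖ ^ 2 := (continuous_gradient hφ).norm.pow 2
  have hgc : HasCompactSupport fun x => ‖gradient φ x‖ ^ 2 :=
    (hasCompactSupport_gradient hφc).comp_left (g := fun y => ‖y‖ ^ 2) (by simp)
  set c := (∫ x in K, φ x) / volume.real K with hc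
  have hgrad : gradient (fun x => φ x - c) = gradient φ := by
    ext1 x
    simp only [gradient, fderiv_sub_const]
  refine ⟨c, ?_⟩
  rw [← hgrad]
  refine integral_sq_le_of_integral_eq_zero hK hKo hKb (hφ.sub contDiff_const) (M := M + |c|)
    (fun x => ?_) ?_ ?_ ?_
  · exact (abs_sub _ _).trans (add_le_add_left (hM x) _)
  · exact (hφc.uniformContinuous_of_continuous hφ.continuous).sub uniformContinuous_const
  · rw [hgrad]
    exact hgc.uniformContinuous_of_continuous cg
  · rw [integral_sub (integrableOn_of_continuous hKb hφ.continuous)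
      (integrableOn_of_continuous hKb continuous_const), setIntegral_const, smul_eq_mul, hc]
    field_simp
    simp

end PayneWeinberger

/-! ### Density of test functions in `H¹₀(Ω)` -/

namespace ReactionDiffusion

open Real Set Filter Topology

variable {m : ℕ}

/-- The pair of an `L₂`-class and its gradient is represented by a test function. -/
def IsTestPair (Ω : Set (Space m)) (p : L2 Ω × L2Vec Ω) : Prop :=
  ∃ φ : Space m → ℝ, IsTest Ω φ ∧
    p.1 =ᵐ[volume.restrict Ω] φ ∧ p.2 =ᵐ[volume.restrict Ω] gradient φ

theorem IsTest.hasGradientAt {Ω : Set (Space m)} {φ : Space m → ℝ} (hφ : IsTest Ω φ)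
    (x : Space m) : HasGradientAt φ (gradient φ x) x :=
  (hφ.1.differentiable (by simp) x).hasGradientAt

theorem isTestPair_zero (Ω : Set (Space m)) : IsTestPair Ω 0 := by
  refine ⟨fun _ => 0, ⟨contDiff_const, HasCompactSupport.zero, ?_⟩, ?_, ?_⟩
  · rw [show (fun _ : Space m => (0 : ℝ)) = 0 from rfl, tsupport_zero]
    exact empty_subset _
  · exact Lp.coeFn_zero _ _ _
  · filter_upwards [Lp.coeFn_zero (Space m) 2 (volume.restrict Ω)] with x hx
    rw [gradient_fun_const]
    exact hx

theorem IsTestPair.add {Ω : Set (Space m)} {p q : L2 Ω × L2Vec Ω} (hp : IsTestPair Ω p)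
    (hq : IsTestPair Ω q) : IsTestPair Ω (p + q) := by
  obtain ⟨φ, hφ, h1, h2⟩ := hp
  obtain ⟨χ, hχ, h3, h4⟩ := hq
  refine ⟨φ + χ, ⟨hφ.1.add hχ.1, hφ.2.1.add hχ.2.1,
    (tsupport_add φ χ).trans (union_subset hφ.2.2 hχ.2.2)⟩, ?_, ?_⟩
  · exact (Lp.coeFn_add _ _).trans (h1.add h3)
  · refine (Lp.coeFn_add _ _).trans ((h2.add h4).trans (Eventually.of_forall fun x => ?_))
    have := ((hφ.hasGradientAt x).hasFDerivAt.add (hχ.hasGradientAt x).hasFDerivAt)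
    rw [← map_add] at this
    exact (hasGradientAt_iff_hasFDerivAt.2 this).gradient.symm

theorem IsTestPair.smul {Ω : Set (Space m)} {p : L2 Ω × L2Vec Ω} (hp : IsTestPair Ω p) (c : ℝ) :
    IsTestPair Ω (c • p) := by
  obtain ⟨φ, hφ, h1, h2⟩ := hp
  refine ⟨c • φ, ⟨hφ.1.const_smul c, hφ.2.1.smul_left (f := fun _ => c),
    (tsupport_smul_subset_right (fun _ => c) φ).trans hφ.2.2⟩, ?_, ?_⟩
  · exact (Lp.coeFn_smul _ _).trans (h1.const_smul c)
  · refine (Lp.coeFn_smul _ _).trans ((h2.const_smul c).trans (Eventually.of_forall fun x => ?_))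
    have := ((hφ.hasGradientAt x).hasFDerivAt.const_smul c)
    rw [← map_smul] at this
    exact (hasGradientAt_iff_hasFDerivAt.2 this).gradient.symm

/-- A closed condition on `H¹₀(Ω)` has to be verified for test functions only. -/
theorem mem_of_mem_H10 {Ω : Set (Space m)} {S : Set (L2 Ω × L2Vec Ω)} (hS : IsClosed S)
    (h : ∀ p, IsTestPair Ω p → p ∈ S) {w : L2 Ω × L2Vec Ω} (hw : w ∈ H10 Ω) : w ∈ S := by
  refine closure_minimal (fun p hp => h p ?_) hS hw
  exact Submodule.span_induction (p := fun p _ => IsTestPair Ω p) (fun p hp => hp)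
    (isTestPair_zero Ω) (fun p q _ _ hp hq => hp.add hq) (fun c p _ hp => hp.smul c) hp

/-- Integration by parts of an `H(Ω, div)` field against `H¹₀(Ω)`. -/
theorem IsHdiv.inner_eq {Ω : Set (Space m)} {z : L2Vec Ω × L2 Ω} (hz : IsHdiv Ω z)
    {w : L2 Ω × L2Vec Ω} (hw : w ∈ H10 Ω) :
    (inner ℝ z.1 w.2 : ℝ) = -inner ℝ z.2 w.1 := by
  refine mem_of_mem_H10 (S := {w | (inner ℝ z.1 w.2 : ℝ) = -inner ℝ z.2 w.1})
    (isClosed_eq (by fun_prop) (by fun_prop)) ?_ hw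
  rintro p ⟨φ, hφ, h1, h2⟩
  simp only [mem_ofPred_eq, L2.inner_def]
  have e1 : ∫ x, inner ℝ (z.1 x) (p.2 x) ∂volume.restrict Ω =
      ∫ x in Ω, inner ℝ (z.1 x) (gradient φ x) := by
    refine integral_congr_ae ?_
    filter_upwards [h2] with x hx
    rw [hx]
  have e2 : ∫ x, inner ℝ (z.2 x) (p.1 x) ∂volume.restrict Ω = ∫ x in Ω, φ x * z.2 x := by
    refine integral_congr_ae ?_
    filter_upwards [h1] with x hx
    rw [hx]
    rfl
  rw [e1, e2]
  exact hz φ hφ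

/-- The Payne–Weinberger inequality on `H¹₀(Ω)`, in the dual form in which it is used: a function
with mean value zero on a convex subset is tested against an element of `H¹₀(Ω)`. -/
theorem sq_inner_restrict_le {Ω τ : Set (Space m)} (hτΩ : τ ⊆ Ω) (hτ : Convex ℝ τ)
    (hτo : IsOpen τ) (hτb : Bornology.IsBounded τ)
    {g : Lp ℝ 2 ((volume.restrict Ω).restrict τ)}
    (hg : ∫ x, g x ∂(volume.restrict Ω).restrict τ = 0) {w : L2 Ω × L2Vec Ω} (hw : w ∈ H10 Ω) :
    (inner ℝ g (LpToLpRestrictCLM (Space m) ℝ ℝ (volume.restrict Ω) 2 τ w.1) : ℝ) ^ 2 ≤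
      ‖g‖ ^ 2 * ((Metric.diam τ / π) ^ 2 *
        ‖LpToLpRestrictCLM (Space m) (Space m) ℝ (volume.restrict Ω) 2 τ w.2‖ ^ 2) := by
  have hμ : (volume.restrict Ω).restrict τ = volume.restrict τ :=
    Measure.restrict_restrict_of_subset hτΩ
  have hfin : IsFiniteMeasure ((volume.restrict Ω).restrict τ) := by
    rw [hμ]
    exact ⟨by simpa using hτb.measure_lt_top⟩
  refine mem_of_mem_H10 (S := {w | (inner ℝ g
    (LpToLpRestrictCLM (Space m) ℝ ℝ (volume.restrict Ω) 2 τ w.1) : ℝ) ^ 2 ≤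
      ‖g‖ ^ 2 * ((Metric.diam τ / π) ^ 2 *
        ‖LpToLpRestrictCLM (Space m) (Space m) ℝ (volume.restrict Ω) 2 τ w.2‖ ^ 2)})
    (isClosed_le (by fun_prop) (by fun_prop)) ?_ hw
  rintro p ⟨φ, hφ, h1, h2⟩
  simp only [mem_ofPred_eq]
  set G := LpToLpRestrictCLM (Space m) ℝ ℝ (volume.restrict Ω) 2 τ p.1 with hG
  set D := LpToLpRestrictCLM (Space m) (Space m) ℝ (volume.restrict Ω) 2 τ p.2 with hD
  have hG1 : G =ᵐ[(volume.restrict Ω).restrict τ] φ :=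
    (LpToLpRestrictCLM_coeFn ℝ τ p.1).trans (ae_restrict_of_ae h1)
  have hD1 : D =ᵐ[(volume.restrict Ω).restrict τ] gradient φ :=
    (LpToLpRestrictCLM_coeFn ℝ τ p.2).trans (ae_restrict_of_ae h2)
  obtain ⟨c, hc⟩ := PayneWeinberger.exists_integral_sub_sq_le hτ hτo hτb
    (hφ.1.of_le (by simp)) hφ.2.1
  let C : Lp ℝ 2 ((volume.restrict Ω).restrict τ) := Lp.const 2 _ c
  have hC : C =ᵐ[(volume.restrict Ω).restrict τ] fun _ => c := Lp.coeFn_const _ _ _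
  have hgC : (inner ℝ g C : ℝ) = 0 := by
    rw [L2.inner_def]
    calc ∫ x, inner ℝ (g x) (C x) ∂(volume.restrict Ω).restrict τ
        = ∫ x, c * g x ∂(volume.restrict Ω).restrict τ := by
          refine integral_congr_ae ?_
          filter_upwards [hC] with x hx
          rw [hx]
          rfl
      _ = 0 := by rw [integral_const_mul, hg, mul_zero]
  have hGC : ‖G - C‖ ^ 2 = ∫ x in τ, (φ x - c) ^ 2 := by
    rw [← real_inner_self_eq_norm_sq, L2.inner_def, ← hμ]
    refine integral_congr_ae ?_
    filter_upwards [hG1, hC, Lp.coeFn_sub G C] with x e1 e2 e3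
    rw [e3, Pi.sub_apply, e1, e2]
    simp [sq]
  have hDn : ‖D‖ ^ 2 = ∫ x in τ, ‖gradient φ x‖ ^ 2 := by
    rw [← real_inner_self_eq_norm_sq, L2.inner_def, ← hμ]
    refine integral_congr_ae ?_
    filter_upwards [hD1] with x e1
    rw [e1, real_inner_self_eq_norm_sq]
  calc (inner ℝ g G : ℝ) ^ 2 = (inner ℝ g (G - C)) ^ 2 := by rw [inner_sub_right, hgC, sub_zero]
    _ ≤ (‖g‖ * ‖G - C‖) ^ 2 :=
        sq_le_sq' (by linarith [(abs_le.1 (abs_real_inner_le_norm g (G - C))).1])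
          (real_inner_le_norm _ _)
    _ = ‖g‖ ^ 2 * ∫ x in τ, (φ x - c) ^ 2 := by rw [mul_pow, hGC]
    _ ≤ _ := by
        rw [hDn]
        gcongr

end ReactionDiffusion

/-! ### The coefficient matrix -/

namespace ReactionDiffusion

open Real Set Filter Topology

variable {m : ℕ}

/-- Ellipticity of one symmetric matrix. -/
structure IsElliptic (M : Matrix (Fin m) (Fin m) ℝ) (μ₁ μ₂ : ℝ) : Prop where
  symm : M.IsSymm
  pos : 0 < μ₁
  lower : ∀ ξ : Fin m → ℝ, μ₁ * (ξ ⬝ᵥ ξ) ≤ (M *ᵥ ξ) ⬝ᵥ ξ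
  upper : ∀ ξ : Fin m → ℝ, (M *ᵥ ξ) ⬝ᵥ ξ ≤ μ₂ * (ξ ⬝ᵥ ξ)

theorem IsCoefficient.isElliptic {Ω : Set (Space m)} {A : Space m → Matrix (Fin m) (Fin m) ℝ}
    {μ₁ μ₂ : ℝ} (hA : IsCoefficient Ω A μ₁ μ₂) {x : Space m} (hx : x ∈ Ω) :
    IsElliptic (A x) μ₁ μ₂ :=
  ⟨hA.symm x hx, hA.pos, hA.lower x hx, hA.upper x hx⟩

theorem real_dotProduct_self_nonneg (ξ : Fin m → ℝ) : 0 ≤ ξ ⬝ᵥ ξ :=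
  Finset.sum_nonneg fun i _ => mul_self_nonneg (ξ i)

namespace IsElliptic

variable {M : Matrix (Fin m) (Fin m) ℝ} {μ₁ μ₂ : ℝ}

theorem mulVec_dotProduct_comm (hM : IsElliptic M μ₁ μ₂) (ξ η : Fin m → ℝ) :
    (M *ᵥ ξ) ⬝ᵥ η = (M *ᵥ η) ⬝ᵥ ξ := by
  rw [dotProduct_comm, Matrix.dotProduct_mulVec, ← Matrix.mulVec_transpose, hM.symm.eq]

theorem nonneg (hM : IsElliptic M μ₁ μ₂) (ξ : Fin m → ℝ) : 0 ≤ (M *ᵥ ξ) ⬝ᵥ ξ :=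
  (mul_nonneg hM.pos.le (real_dotProduct_self_nonneg ξ)).trans (hM.lower ξ)

theorem isUnit_det (hM : IsElliptic M μ₁ μ₂) : IsUnit M.det := by
  rw [isUnit_iff_ne_zero]
  intro h
  obtain ⟨ξ, hξ, h0⟩ := Matrix.exists_mulVec_eq_zero_iff.2 h
  have := hM.lower ξ
  rw [h0, zero_dotProduct] at this
  have h1 := real_dotProduct_self_nonneg ξ
  have h2 : ξ ⬝ᵥ ξ = 0 := by nlinarith [hM.pos]
  exact hξ (dotProduct_self_eq_zero.1 h2)

theorem mulVec_inv_mulVec (hM : IsElliptic M μ₁ μ₂) (y : Fin m → ℝ) : M *ᵥ (M⁻¹ *ᵥ y) = y := by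
  rw [Matrix.mulVec_mulVec, Matrix.mul_nonsing_inv _ hM.isUnit_det, Matrix.one_mulVec]

theorem inv_mulVec_mulVec (hM : IsElliptic M μ₁ μ₂) (y : Fin m → ℝ) : M⁻¹ *ᵥ (M *ᵥ y) = y := by
  rw [Matrix.mulVec_mulVec, Matrix.nonsing_inv_mul _ hM.isUnit_det, Matrix.one_mulVec]

theorem inv_nonneg (hM : IsElliptic M μ₁ μ₂) (y : Fin m → ℝ) : 0 ≤ (M⁻¹ *ᵥ y) ⬝ᵥ y := by
  have := hM.nonneg (M⁻¹ *ᵥ y)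
  rwa [hM.mulVec_inv_mulVec, dotProduct_comm] at this

/-- Young's inequality for the dual pair of norms given by `M` and `M⁻¹`. -/
theorem two_mul_dotProduct_le (hM : IsElliptic M μ₁ μ₂) (y ξ : Fin m → ℝ) {s : ℝ} (hs : 0 < s) :
    2 * (y ⬝ᵥ ξ) ≤ s * ((M⁻¹ *ᵥ y) ⬝ᵥ y) + s⁻¹ * ((M *ᵥ ξ) ⬝ᵥ ξ) := by
  have h := hM.nonneg (s • (M⁻¹ *ᵥ y) - ξ)
  rw [Matrix.mulVec_sub, Matrix.mulVec_smul, hM.mulVec_inv_mulVec] at h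
  have e : (s • y - M *ᵥ ξ) ⬝ᵥ (s • (M⁻¹ *ᵥ y) - ξ) =
      s * (s * ((M⁻¹ *ᵥ y) ⬝ᵥ y)) - s * (2 * (y ⬝ᵥ ξ)) + (M *ᵥ ξ) ⬝ᵥ ξ := by
    have e1 : (M *ᵥ ξ) ⬝ᵥ (M⁻¹ *ᵥ y) = y ⬝ᵥ ξ := by
      rw [hM.mulVec_dotProduct_comm, hM.mulVec_inv_mulVec]
    simp only [sub_dotProduct, dotProduct_sub, smul_dotProduct, dotProduct_smul, smul_eq_mul, e1]
    rw [dotProduct_comm y (M⁻¹ *ᵥ y)]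
    ring
  rw [e] at h
  have h2 := mul_nonneg (inv_pos.2 hs).le h
  have h3 : s⁻¹ * (s * (s * ((M⁻¹ *ᵥ y) ⬝ᵥ y)) - s * (2 * (y ⬝ᵥ ξ)) + (M *ᵥ ξ) ⬝ᵥ ξ) =
      s * ((M⁻¹ *ᵥ y) ⬝ᵥ y) - 2 * (y ⬝ᵥ ξ) + s⁻¹ * ((M *ᵥ ξ) ⬝ᵥ ξ) := by
    field_simp
  linarith

theorem abs_mulVec_dotProduct_le (hM : IsElliptic M μ₁ μ₂) (ξ η : Fin m → ℝ) :
    |(M *ᵥ ξ) ⬝ᵥ η| ≤ |μ₂| * (ξ ⬝ᵥ ξ) + |μ₂| * (η ⬝ᵥ η) := by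
  have h1 := hM.nonneg (ξ + η)
  have h2 := hM.nonneg (ξ - η)
  have h3 := hM.upper ξ
  have h4 := hM.upper η
  have h5 := mul_le_mul_of_nonneg_right (le_abs_self μ₂) (real_dotProduct_self_nonneg ξ)
  have h6 := mul_le_mul_of_nonneg_right (le_abs_self μ₂) (real_dotProduct_self_nonneg η)
  have h7 := mul_nonneg (abs_nonneg μ₂) (real_dotProduct_self_nonneg ξ)
  have h8 := mul_nonneg (abs_nonneg μ₂) (real_dotProduct_self_nonneg η)
  simp only [Matrix.mulVec_add, Matrix.mulVec_sub, add_dotProduct, dotProduct_add, sub_dotProduct,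
    dotProduct_sub, hM.mulVec_dotProduct_comm η ξ] at h1 h2
  rw [abs_le]
  constructor <;> linarith

theorem inv_mulVec_dotProduct_le (hM : IsElliptic M μ₁ μ₂) (y : Fin m → ℝ) :
    (M⁻¹ *ᵥ y) ⬝ᵥ y ≤ μ₁⁻¹ * (y ⬝ᵥ y) := by
  have h1 := hM.lower (M⁻¹ *ᵥ y)
  rw [hM.mulVec_inv_mulVec, dotProduct_comm y] at h1
  have h2 := real_dotProduct_self_nonneg (μ₁ • (M⁻¹ *ᵥ y) - y)
  simp only [sub_dotProduct, dotProduct_sub, smul_dotProduct, dotProduct_smul, smul_eq_mul,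
    dotProduct_comm y (M⁻¹ *ᵥ y)] at h2
  have h3 := mul_le_mul_of_nonneg_left h1 hM.pos.le
  have h4 : μ₁ * ((M⁻¹ *ᵥ y) ⬝ᵥ y) ≤ y ⬝ᵥ y := by linarith
  rw [← div_eq_inv_mul, le_div_iff₀ hM.pos]
  linarith

end IsElliptic

variable {Ω : Set (Space m)} {A : Space m → Matrix (Fin m) (Fin m) ℝ} {μ₁ μ₂ : ℝ}

theorem dotProduct_eq_inner (ξ η : Space m) : ξ.ofLp ⬝ᵥ η.ofLp = inner ℝ ξ η := by
  rw [EuclideanSpace.inner_eq_star_dotProduct, dotProduct_comm]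
  rfl

theorem aemeasurable_ofLp_apply {μ : Measure (Space m)} {X : Space m → Space m}
    (hX : AEMeasurable X μ) (i : Fin m) : AEMeasurable (fun x => (X x).ofLp i) μ :=
  (EuclideanSpace.proj (𝕜 := ℝ) i).continuous.measurable.comp_aemeasurable hX

theorem aemeasurable_mulVec_dotProduct {μ : Measure (Space m)}
    {B : Space m → Matrix (Fin m) (Fin m) ℝ} (hB : ∀ i j, AEMeasurable (fun x => B x i j) μ)
    {X Y : Space m → Space m} (hX : AEMeasurable X μ) (hY : AEMeasurable Y μ) :
    AEMeasurable (fun x => (B x *ᵥ (X x).ofLp) ⬝ᵥ (Y x).ofLp) μ := by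
  simp only [Matrix.mulVec, dotProduct]
  refine Finset.aemeasurable_fun_sum _ fun i _ => AEMeasurable.mul
    (Finset.aemeasurable_fun_sum _ fun j _ => (hB i j).mul (aemeasurable_ofLp_apply hX j))
    (aemeasurable_ofLp_apply hY i)

theorem aemeasurable_inv {μ : Measure (Space m)}
    {B : Space m → Matrix (Fin m) (Fin m) ℝ} (hB : ∀ i j, AEMeasurable (fun x => B x i j) μ)
    (i j : Fin m) : AEMeasurable (fun x => (B x)⁻¹ i j) μ := by
  let C : Space m → Fin m → Fin m → ℝ := fun x i j => B x i j
  have hC : AEMeasurable C μ := aemeasurable_pi_lambda _ fun i => aemeasurable_pi_lambda _ (hB i)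
  have hdet : Continuous fun N : Fin m → Fin m → ℝ => (Matrix.of N).det :=
    Continuous.matrix_det (continuous_id : Continuous fun N : Fin m → Fin m → ℝ => N)
  have hadj : Continuous fun N : Fin m → Fin m → ℝ => (Matrix.of N).adjugate i j :=
    Continuous.matrix_elem (Continuous.matrix_adjugate
      (continuous_id : Continuous fun N : Fin m → Fin m → ℝ => N)) i j
  have h1 := hdet.measurable.comp_aemeasurable hC
  have h2 := hadj.measurable.comp_aemeasurable hC
  refine (h1.inv.mul h2).congr (Eventually.of_forall fun x => ?_)
  simp only [Pi.mul_apply, Matrix.inv_def, Matrix.smul_apply, Ring.inverse_eq_inv', smul_eq_mul]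
  rfl

theorem integrable_dotProduct_self (X : L2Vec Ω) :
    Integrable (fun x => (X x).ofLp ⬝ᵥ (X x).ofLp) (volume.restrict Ω) := by
  simp_rw [dotProduct_eq_inner]
  exact L2.integrable_inner X X

theorem integrable_mulVec_dotProduct (hΩ : IsOpen Ω) (hA : IsCoefficient Ω A μ₁ μ₂)
    (X Y : L2Vec Ω) :
    Integrable (fun x => (A x *ᵥ (X x).ofLp) ⬝ᵥ (Y x).ofLp) (volume.restrict Ω) := by
  refine (((integrable_dotProduct_self X).const_mul |μ₂|).add
    ((integrable_dotProduct_self Y).const_mul |μ₂|)).mono'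
    (aemeasurable_mulVec_dotProduct hA.measurable (Lp.aestronglyMeasurable X).aemeasurable
      (Lp.aestronglyMeasurable Y).aemeasurable).aestronglyMeasurable ?_
  filter_upwards [ae_restrict_mem hΩ.measurableSet] with x hx
  exact (hA.isElliptic hx).abs_mulVec_dotProduct_le _ _

theorem integrable_inv_mulVec_dotProduct (hΩ : IsOpen Ω) (hA : IsCoefficient Ω A μ₁ μ₂)
    (Z : L2Vec Ω) :
    Integrable (fun x => ((A x)⁻¹ *ᵥ (Z x).ofLp) ⬝ᵥ (Z x).ofLp) (volume.restrict Ω) := by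
  refine ((integrable_dotProduct_self Z).const_mul μ₁⁻¹).mono'
    (aemeasurable_mulVec_dotProduct (aemeasurable_inv hA.measurable)
      (Lp.aestronglyMeasurable Z).aemeasurable
      (Lp.aestronglyMeasurable Z).aemeasurable).aestronglyMeasurable ?_
  filter_upwards [ae_restrict_mem hΩ.measurableSet] with x hx
  rw [norm_eq_abs, abs_of_nonneg ((hA.isElliptic hx).inv_nonneg _)]
  exact (hA.isElliptic hx).inv_mulVec_dotProduct_le _

/-- The flux error `‖A∇v + z‖²_{A⁻¹}` is finite; its integrand expands to
`A∇v·∇v + 2 z·∇v + A⁻¹z·z`. -/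
theorem integrable_flux_error (hΩ : IsOpen Ω) (hA : IsCoefficient Ω A μ₁ μ₂) (X Z : L2Vec Ω) :
    Integrable (fun x => ((A x)⁻¹ *ᵥ (A x *ᵥ (X x).ofLp + (Z x).ofLp)) ⬝ᵥ
      (A x *ᵥ (X x).ofLp + (Z x).ofLp)) (volume.restrict Ω) := by
  refine (((integrable_mulVec_dotProduct hΩ hA X X).add
    ((L2.integrable_inner (𝕜 := ℝ) Z X).const_mul 2)).add
      (integrable_inv_mulVec_dotProduct hΩ hA Z)).congr ?_
  filter_upwards [ae_restrict_mem hΩ.measurableSet] with x hx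
  have hE := hA.isElliptic hx
  have e1 : ((A x)⁻¹ *ᵥ (Z x).ofLp) ⬝ᵥ (A x *ᵥ (X x).ofLp) = (Z x).ofLp ⬝ᵥ (X x).ofLp := by
    rw [dotProduct_comm, hE.mulVec_dotProduct_comm, hE.mulVec_inv_mulVec]
  simp only [Pi.add_apply, Matrix.mulVec_add, hE.inv_mulVec_mulVec, add_dotProduct,
    dotProduct_add, e1, ← dotProduct_eq_inner]
  rw [dotProduct_comm (X x).ofLp (A x *ᵥ _), dotProduct_comm (X x).ofLp (Z x).ofLp]
  ring

end ReactionDiffusion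

/-! ### The energy identity -/

namespace ReactionDiffusion

open Real Set Filter Topology

variable {m : ℕ} {Ω : Set (Space m)} {A : Space m → Matrix (Fin m) (Fin m) ℝ} {μ₁ μ₂ : ℝ}

theorem integral_mul_eq_inner {μ : Measure (Space m)} (f g : Lp ℝ 2 μ) :
    ∫ x, f x * g x ∂μ = inner ℝ f g := by
  rw [L2.inner_def]
  exact integral_congr_ae (Eventually.of_forall fun x => mul_comm _ _)

theorem integral_sq_eq_norm_sq {μ : Measure (Space m)} (f : Lp ℝ 2 μ) :
    ∫ x, f x ^ 2 ∂μ = ‖f‖ ^ 2 := by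
  rw [← real_inner_self_eq_norm_sq, ← integral_mul_eq_inner]
  simp_rw [sq]

theorem form_sub_left (hΩ : IsOpen Ω) (hA : IsCoefficient Ω A μ₁ μ₂) (σ : ℝ)
    (u v w : L2 Ω × L2Vec Ω) : form Ω A σ (u - v) w = form Ω A σ u w - form Ω A σ v w := by
  have e : ∫ x in Ω, (A x *ᵥ ((u - v).2 x).ofLp) ⬝ᵥ (w.2 x).ofLp =
      (∫ x in Ω, (A x *ᵥ (u.2 x).ofLp) ⬝ᵥ (w.2 x).ofLp) -
        ∫ x in Ω, (A x *ᵥ (v.2 x).ofLp) ⬝ᵥ (w.2 x).ofLp := by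
    rw [← integral_sub (integrable_mulVec_dotProduct hΩ hA _ _)
      (integrable_mulVec_dotProduct hΩ hA _ _)]
    refine integral_congr_ae ?_
    filter_upwards [Lp.coeFn_sub u.2 v.2] with x hx
    rw [Prod.snd_sub, hx, Pi.sub_apply, WithLp.ofLp_sub, Matrix.mulVec_sub, sub_dotProduct]
  simp only [form, e, integral_mul_eq_inner, Prod.fst_sub, inner_sub_left]
  ring

theorem form_sub_right (hΩ : IsOpen Ω) (hA : IsCoefficient Ω A μ₁ μ₂) (σ : ℝ)
    (u v w : L2 Ω × L2Vec Ω) : form Ω A σ u (v - w) = form Ω A σ u v - form Ω A σ u w := by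
  have e : ∫ x in Ω, (A x *ᵥ (u.2 x).ofLp) ⬝ᵥ ((v - w).2 x).ofLp =
      (∫ x in Ω, (A x *ᵥ (u.2 x).ofLp) ⬝ᵥ (v.2 x).ofLp) -
        ∫ x in Ω, (A x *ᵥ (u.2 x).ofLp) ⬝ᵥ (w.2 x).ofLp := by
    rw [← integral_sub (integrable_mulVec_dotProduct hΩ hA _ _)
      (integrable_mulVec_dotProduct hΩ hA _ _)]
    refine integral_congr_ae ?_
    filter_upwards [Lp.coeFn_sub v.2 w.2] with x hx
    rw [Prod.snd_sub, hx, Pi.sub_apply, WithLp.ofLp_sub, dotProduct_sub]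
  simp only [form, e, integral_mul_eq_inner, Prod.fst_sub, inner_sub_right]
  ring

theorem sqNormA_eq (Ω : Set (Space m)) (A : Space m → Matrix (Fin m) (Fin m) ℝ)
    (u : L2 Ω × L2Vec Ω) :
    sqNormA Ω A u = ∫ x in Ω, (A x *ᵥ (u.2 x).ofLp) ⬝ᵥ (u.2 x).ofLp := by
  simp only [sqNormA, dotProduct_comm]

theorem form_self (Ω : Set (Space m)) (A : Space m → Matrix (Fin m) (Fin m) ℝ) (σ : ℝ)
    (u : L2 Ω × L2Vec Ω) : form Ω A σ u u = sqEnergy Ω A σ u := by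
  rw [form, sqEnergy, sqNormA_eq, integral_mul_eq_inner, real_inner_self_eq_norm_sq]

theorem sqNormA_sub_comm (Ω : Set (Space m)) (A : Space m → Matrix (Fin m) (Fin m) ℝ)
    (u v : L2 Ω × L2Vec Ω) : sqNormA Ω A (u - v) = sqNormA Ω A (v - u) := by
  refine integral_congr_ae ?_
  filter_upwards [Lp.coeFn_sub v.2 u.2, Lp.coeFn_sub u.2 v.2] with x h1 h2
  rw [Prod.snd_sub, Prod.snd_sub, h1, h2, Pi.sub_apply, Pi.sub_apply, ← neg_sub (v.2 x) (u.2 x),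
    WithLp.ofLp_neg, Matrix.mulVec_neg, neg_dotProduct_neg]

/-- The residual of `v` against `w ∈ H¹₀(Ω)`, with a test flux `z` inserted by integration by
parts. -/
theorem form_sub_inner_eq (hΩ : IsOpen Ω) (hA : IsCoefficient Ω A μ₁ μ₂) (σ : ℝ) (f g : L2 Ω)
    (v : L2 Ω × L2Vec Ω) {w : L2 Ω × L2Vec Ω} (hw : w ∈ H10 Ω) {z : L2Vec Ω × L2 Ω}
    (hz : IsHdiv Ω z) :
    form Ω A σ v w - inner ℝ f w.1 =
      (∫ x in Ω, (A x *ᵥ (v.2 x).ofLp + (z.1 x).ofLp) ⬝ᵥ (w.2 x).ofLp) -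
        inner ℝ (g - σ • v.1 - z.2) w.1 - inner ℝ (f - g) w.1 := by
  have e : ∫ x in Ω, (A x *ᵥ (v.2 x).ofLp + (z.1 x).ofLp) ⬝ᵥ (w.2 x).ofLp =
      (∫ x in Ω, (A x *ᵥ (v.2 x).ofLp) ⬝ᵥ (w.2 x).ofLp) + inner ℝ z.1 w.2 := by
    rw [L2.inner_def, ← integral_add (integrable_mulVec_dotProduct hΩ hA _ _)
      (L2.integrable_inner _ _)]
    refine integral_congr_ae (Eventually.of_forall fun x => ?_)
    simp only [add_dotProduct, dotProduct_eq_inner]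
  rw [e, hz.inner_eq hw, form, integral_mul_eq_inner]
  simp only [inner_sub_left, real_inner_smul_left]
  ring

/-- Young's inequality in integrated form. -/
theorem two_mul_integral_dotProduct_le (hΩ : IsOpen Ω) (hA : IsCoefficient Ω A μ₁ μ₂)
    (X Z : L2Vec Ω) (w : L2 Ω × L2Vec Ω) {s : ℝ} (hs : 0 < s) :
    2 * (∫ x in Ω, (A x *ᵥ (X x).ofLp + (Z x).ofLp) ⬝ᵥ (w.2 x).ofLp) ≤
      s * (∫ x in Ω, ((A x)⁻¹ *ᵥ (A x *ᵥ (X x).ofLp + (Z x).ofLp)) ⬝ᵥ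
        (A x *ᵥ (X x).ofLp + (Z x).ofLp)) + s⁻¹ * sqNormA Ω A w := by
  have i1 : Integrable (fun x => (A x *ᵥ (X x).ofLp + (Z x).ofLp) ⬝ᵥ (w.2 x).ofLp)
      (volume.restrict Ω) := by
    refine ((integrable_mulVec_dotProduct hΩ hA X w.2).add
      (L2.integrable_inner (𝕜 := ℝ) Z w.2)).congr (Eventually.of_forall fun x => ?_)
    simp only [Pi.add_apply, add_dotProduct, dotProduct_eq_inner]
  have i2 := integrable_flux_error hΩ hA X Z
  have i3 := integrable_mulVec_dotProduct hΩ hA w.2 w.2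
  rw [sqNormA_eq, ← integral_const_mul, ← integral_const_mul, ← integral_const_mul,
    ← integral_add (i2.const_mul s) (i3.const_mul s⁻¹)]
  refine integral_mono_ae (i1.const_mul 2) ((i2.const_mul s).add (i3.const_mul s⁻¹)) ?_
  filter_upwards [ae_restrict_mem hΩ.measurableSet] with x hx
  exact (hA.isElliptic hx).two_mul_dotProduct_le _ _ hs

theorem neg_two_mul_le_of_sq_le {x P N s : ℝ} (hP : 0 ≤ P) (hN : 0 ≤ N) (hs : 0 < s)
    (h : x ^ 2 ≤ P * N) : -(2 * x) ≤ s * P + s⁻¹ * N := by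
  have h1 : 0 ≤ s * P + s⁻¹ * N := by positivity
  refine le_of_abs_le (abs_le_of_sq_le_sq ?_ h1)
  have e : (s * P + s⁻¹ * N) ^ 2 = (s * P - s⁻¹ * N) ^ 2 + 4 * (P * N) := by
    field_simp
    ring
  nlinarith [sq_nonneg (s * P - s⁻¹ * N)]

theorem neg_two_mul_inner_le {μ : Measure (Space m)} (f g : Lp ℝ 2 μ) {s : ℝ} (hs : 0 < s) :
    -(2 * inner ℝ f g) ≤ s * ‖f‖ ^ 2 + s⁻¹ * ‖g‖ ^ 2 := by
  refine neg_two_mul_le_of_sq_le (sq_nonneg _) (sq_nonneg _) hs ?_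
  rw [← mul_pow]
  exact sq_le_sq' (by linarith [(abs_le.1 (abs_real_inner_le_norm f g)).1])
    (real_inner_le_norm _ _)

/-- The basic error estimate, before the choice of the parameters in Young's inequality. -/
theorem two_mul_sqEnergy_le (hΩ : IsOpen Ω) (hA : IsCoefficient Ω A μ₁ μ₂) {σ : ℝ} {f : L2 Ω}
    {ψ u v : L2 Ω × L2Vec Ω} (hu : IsWeakSolution Ω A σ f ψ u) (he : v - u ∈ H10 Ω)
    {z : L2Vec Ω × L2 Ω} (hz : IsHdiv Ω z) (g : L2 Ω) {s t : ℝ} (hs : 0 < s) (ht : 0 < t) :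
    2 * sqEnergy Ω A σ (v - u) ≤
      s * (∫ x in Ω, ((A x)⁻¹ *ᵥ (A x *ᵥ (v.2 x).ofLp + (z.1 x).ofLp)) ⬝ᵥ
        (A x *ᵥ (v.2 x).ofLp + (z.1 x).ofLp)) + s⁻¹ * sqNormA Ω A (v - u) +
      (t * ‖g - σ • v.1 - z.2‖ ^ 2 + t⁻¹ * ‖(v - u).1‖ ^ 2) -
        2 * inner ℝ (f - g) (v - u).1 := by
  have h1 : sqEnergy Ω A σ (v - u) = form Ω A σ v (v - u) - inner ℝ f (v - u).1 := by
    rw [← form_self, form_sub_left hΩ hA, hu.2.2 _ he, integral_mul_eq_inner]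
  have h2 := form_sub_inner_eq hΩ hA σ f g v he hz
  have h3 := two_mul_integral_dotProduct_le hΩ hA v.2 z.1 (v - u) hs
  have h4 := neg_two_mul_inner_le (g - σ • v.1 - z.2) (v - u).1 ht
  linarith

theorem majorant_eq (σ σs : ℝ) {g : Space m → ℝ} {G : L2 Ω} (hG : G =ᵐ[volume.restrict Ω] g)
    (v : L2 Ω × L2Vec Ω) (z : L2Vec Ω × L2 Ω) :
    majorant Ω A σ σs g v z =
      (∫ x in Ω, ((A x)⁻¹ *ᵥ (A x *ᵥ (v.2 x).ofLp + (z.1 x).ofLp)) ⬝ᵥ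
        (A x *ᵥ (v.2 x).ofLp + (z.1 x).ofLp)) +
      thetaSmall σ σs * ‖G - σ • v.1 - z.2‖ ^ 2 := by
  rw [majorant, ← integral_sq_eq_norm_sq]
  congr 2
  refine integral_congr_ae ?_
  filter_upwards [hG, Lp.coeFn_sub (G - σ • v.1) z.2, Lp.coeFn_sub G (σ • v.1),
    Lp.coeFn_smul σ v.1] with x h1 h2 h3 h4
  rw [h2, Pi.sub_apply, h3, Pi.sub_apply, h4, h1]
  rfl

theorem sqNormA_nonneg (hΩ : IsOpen Ω) (hA : IsCoefficient Ω A μ₁ μ₂) (w : L2 Ω × L2Vec Ω) :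
    0 ≤ sqNormA Ω A w := by
  rw [sqNormA_eq]
  refine integral_nonneg_of_ae ?_
  filter_upwards [ae_restrict_mem hΩ.measurableSet] with x hx
  exact (hA.isElliptic hx).nonneg _

end ReactionDiffusion

/-! ### Data oscillation on a convex partition -/

namespace ReactionDiffusion

open Real Set Filter Topology

variable {m R : ℕ} {Ω : Set (Space m)} {τ : Fin R → Set (Space m)}

theorem IsConvexPartition.subset (hτ : IsConvexPartition Ω τ) (r : Fin R) : τ r ⊆ Ω := by
  rw [hτ.cover]
  exact interior_maximal (subset_closure.trans (subset_iUnion (fun r => closure (τ r)) r))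
    (hτ.isOpen r)

theorem IsConvexPartition.ae_mem (hτ : IsConvexPartition Ω τ) (hΩ : IsOpen Ω) :
    ∀ᵐ x ∂volume.restrict Ω, x ∈ ⋃ r, τ r := by
  have h0 : ∀ᵐ x : Space m, ∀ r, x ∉ frontier (τ r) :=
    ae_all_iff.2 fun r => measure_eq_zero_iff_ae_notMem.1 ((hτ.convex r).addHaar_frontier volume)
  filter_upwards [ae_restrict_mem hΩ.measurableSet, ae_restrict_of_ae h0] with x hx hfr
  rw [hτ.cover] at hx
  obtain ⟨r, hr⟩ := mem_iUnion.1 (interior_subset hx)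
  refine mem_iUnion.2 ⟨r, ?_⟩
  by_contra hxr
  exact hfr r ⟨hr, by rwa [(hτ.isOpen r).interior_eq]⟩

theorem IsConvexPartition.integral_eq_sum (hτ : IsConvexPartition Ω τ) (hΩ : IsOpen Ω)
    {F : Space m → ℝ} (hF : Integrable F (volume.restrict Ω)) :
    ∫ x in Ω, F x = ∑ r, ∫ x, F x ∂(volume.restrict Ω).restrict (τ r) := by
  rw [← integral_iUnion_fintype (fun r => (hτ.isOpen r).measurableSet) hτ.disjoint
    (fun r => hF.integrableOn), Measure.restrict_eq_self_of_ae_mem (hτ.ae_mem hΩ)]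

theorem piecewiseProj_eq (hτ : IsConvexPartition Ω τ) (f : L2 Ω) {r : Fin R} {x : Space m}
    (hx : x ∈ τ r) : piecewiseProj τ f x = localProj (τ r) f x := by
  rw [piecewiseProj, Finset.sum_eq_single r, indicator_of_mem hx]
  · intro s _ hs
    exact indicator_of_notMem (disjoint_right.1 (hτ.disjoint hs) hx) _
  · simp

theorem memLp_piecewiseProj (hτ : IsConvexPartition Ω τ) (f : L2 Ω) :
    MemLp (piecewiseProj τ f) 2 (volume.restrict Ω) := by
  unfold piecewiseProj
  refine memLp_finsetSum _ fun r _ => ?_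
  rw [memLp_indicator_iff_restrict (hτ.isOpen r).measurableSet]
  exact Lp.memLp _

/-- The local error `f - Π¹f` on `τ`. -/
noncomputable def localError (τ : Set (Space m)) (f : L2 Ω) :
    Lp ℝ 2 ((volume.restrict Ω).restrict τ) :=
  LpToLpRestrictCLM (Space m) ℝ ℝ (volume.restrict Ω) 2 τ f - localProj τ f

theorem localError_ae_eq (τ : Set (Space m)) (f : L2 Ω) :
    localError τ f =ᵐ[(volume.restrict Ω).restrict τ] fun x => f x - localProj τ f x := by
  filter_upwards [LpToLpRestrictCLM_coeFn ℝ τ f, Lp.coeFn_sub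
    (LpToLpRestrictCLM (Space m) ℝ ℝ (volume.restrict Ω) 2 τ f) (localProj τ f)] with x h1 h2
  rw [localError, h2, Pi.sub_apply, h1]

theorem norm_localError_sq {τ : Set (Space m)} (hτΩ : τ ⊆ Ω) (f : L2 Ω) :
    ‖localError τ f‖ ^ 2 = ∫ x in τ, (f x - localProj τ f x) ^ 2 := by
  rw [← integral_sq_eq_norm_sq, ← Measure.restrict_restrict_of_subset (μ := volume) hτΩ]
  refine integral_congr_ae ?_
  filter_upwards [localError_ae_eq τ f] with x hx
  rw [hx]

/-- The local error has mean value zero, since the constants are polynomials of degree at most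
one. -/
theorem integral_localError {τ : Set (Space m)} (hτb : Bornology.IsBounded τ) (f : L2 Ω) :
    ∫ x, localError τ f x ∂(volume.restrict Ω).restrict τ = 0 := by
  set μ := (volume.restrict Ω).restrict τ with hμ
  have hfin : IsFiniteMeasure μ := by
    refine ⟨?_⟩
    rw [hμ, Measure.restrict_apply_univ]
    exact (Measure.restrict_apply_le _ _).trans_lt hτb.measure_lt_top
  have hmem : ((1, 0) : ℝ × Space m) ∈ affineCoeffs μ := by
    change MemLp (fun x => (1 : ℝ) + inner ℝ (0 : Space m) x) 2 μ
    simpa using memLp_const (1 : ℝ)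
  have h1 : affineToLp μ ⟨(1, 0), hmem⟩ =ᵐ[μ] fun _ => (1 : ℝ) := by
    refine (MemLp.coeFn_toLp (memLp_of_mem_affineCoeffs hmem)).trans
      (Eventually.of_forall fun x => ?_)
    simp
  have h0 : (inner ℝ (affineToLp μ ⟨(1, 0), hmem⟩) (localError τ f) : ℝ) = 0 :=
    Submodule.sub_starProjection_mem_orthogonal (K := affinePolys μ) _ _ ⟨_, rfl⟩
  rw [← integral_mul_eq_inner] at h0
  rw [← h0]
  refine integral_congr_ae ?_
  filter_upwards [h1] with x hx
  rw [hx, one_mul]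

theorem IsConvexPartition.inner_sub_eq_sum (hτ : IsConvexPartition Ω τ) (hΩ : IsOpen Ω)
    (f : L2 Ω) {G : L2 Ω} (hG : G =ᵐ[volume.restrict Ω] piecewiseProj τ f) (w : L2 Ω) :
    (inner ℝ (f - G) w : ℝ) = ∑ r, inner ℝ (localError (τ r) f)
      (LpToLpRestrictCLM (Space m) ℝ ℝ (volume.restrict Ω) 2 (τ r) w) := by
  rw [L2.inner_def, hτ.integral_eq_sum hΩ (L2.integrable_inner _ _)]
  refine Finset.sum_congr rfl fun r _ => ?_
  rw [L2.inner_def]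
  refine integral_congr_ae ?_
  filter_upwards [localError_ae_eq (τ r) f, LpToLpRestrictCLM_coeFn ℝ (τ r) w,
    ae_restrict_of_ae hG, ae_restrict_of_ae (Lp.coeFn_sub f G),
    ae_restrict_mem (hτ.isOpen r).measurableSet] with x h1 h2 h3 h4 h5
  rw [h1, h2, h4, Pi.sub_apply, h3, piecewiseProj_eq hτ f h5]

theorem IsConvexPartition.sum_norm_restrict_sq (hτ : IsConvexPartition Ω τ) (hΩ : IsOpen Ω)
    (w : L2 Ω) :
    ∑ r, ‖LpToLpRestrictCLM (Space m) ℝ ℝ (volume.restrict Ω) 2 (τ r) w‖ ^ 2 = ‖w‖ ^ 2 := by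
  rw [← integral_sq_eq_norm_sq w, hτ.integral_eq_sum hΩ (by
    simpa [sq] using L2.integrable_inner (𝕜 := ℝ) w w)]
  refine Finset.sum_congr rfl fun r _ => ?_
  rw [← integral_sq_eq_norm_sq]
  refine integral_congr_ae ?_
  filter_upwards [LpToLpRestrictCLM_coeFn ℝ (τ r) w] with x hx
  rw [hx]

variable {A : Space m → Matrix (Fin m) (Fin m) ℝ} {μ₁ μ₂ : ℝ}

theorem mul_norm_restrict_sq_le (hΩ : IsOpen Ω) (hA : IsCoefficient Ω A μ₁ μ₂) (τ : Set (Space m))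
    (X : L2Vec Ω) :
    μ₁ * ‖LpToLpRestrictCLM (Space m) (Space m) ℝ (volume.restrict Ω) 2 τ X‖ ^ 2 ≤
      ∫ x, (A x *ᵥ (X x).ofLp) ⬝ᵥ (X x).ofLp ∂(volume.restrict Ω).restrict τ := by
  rw [← real_inner_self_eq_norm_sq, L2.inner_def, ← integral_const_mul]
  refine integral_mono_ae ((L2.integrable_inner _ _).const_mul _)
    (integrable_mulVec_dotProduct hΩ hA X X).integrableOn ?_
  filter_upwards [LpToLpRestrictCLM_coeFn ℝ τ X,
    ae_restrict_of_ae (ae_restrict_mem (μ := volume) hΩ.measurableSet)] with x h1 h2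
  rw [h1, ← dotProduct_eq_inner]
  exact hA.lower x h2 _

/-- The data oscillation tested with `w ∈ H¹₀(Ω)`, absorbed into the gradient of `w` by the
Payne–Weinberger inequality on each subdomain. -/
theorem IsConvexPartition.neg_two_mul_inner_le_gradient (hτ : IsConvexPartition Ω τ)
    (hΩ : IsOpen Ω) (hA : IsCoefficient Ω A μ₁ μ₂)
    (f : L2 Ω) {G : L2 Ω} (hG : G =ᵐ[volume.restrict Ω] piecewiseProj τ f)
    {w : L2 Ω × L2Vec Ω} (hw : w ∈ H10 Ω) {s ε : ℝ} (hs : 0 < s) (hε : 0 < ε) :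
    -(2 * inner ℝ (f - G) w.1) ≤
      s * (∑ r, Metric.diam (τ r) ^ 2 / (ε * μ₁ * π ^ 2) *
        ∫ x in τ r, (f x - localProj (τ r) f x) ^ 2) + s⁻¹ * (ε * sqNormA Ω A w) := by
  have hμ := hA.pos
  rw [hτ.inner_sub_eq_sum hΩ f hG, sqNormA_eq, hτ.integral_eq_sum hΩ
    (integrable_mulVec_dotProduct hΩ hA _ _), Finset.mul_sum, ← Finset.sum_neg_distrib,
    Finset.mul_sum, Finset.mul_sum, Finset.mul_sum, ← Finset.sum_add_distrib]
  refine Finset.sum_le_sum fun r _ => ?_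
  set D := ‖localError (τ r) f‖ ^ 2 with hD
  set N := ∫ x, (A x *ᵥ (w.2 x).ofLp) ⬝ᵥ (w.2 x).ofLp ∂(volume.restrict Ω).restrict (τ r) with hN
  have h1 := sq_inner_restrict_le (hτ.subset r) (hτ.convex r) (hτ.isOpen r) (hτ.bounded r)
    (integral_localError (hτ.bounded r) f) hw
  have h2 := mul_norm_restrict_sq_le hΩ hA (τ r) w.2
  have hD0 : 0 ≤ D := sq_nonneg _
  have hN0 : 0 ≤ N := (by positivity : (0 : ℝ) ≤ _).trans h2
  rw [← norm_localError_sq (hτ.subset r), ← hD]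
  refine neg_two_mul_le_of_sq_le (by positivity) (by positivity) hs (h1.trans ?_)
  calc D * ((Metric.diam (τ r) / π) ^ 2 * ‖LpToLpRestrictCLM (Space m) (Space m) ℝ
        (volume.restrict Ω) 2 (τ r) w.2‖ ^ 2)
      = Metric.diam (τ r) ^ 2 / (ε * μ₁ * π ^ 2) * D * (ε * (μ₁ *
        ‖LpToLpRestrictCLM (Space m) (Space m) ℝ (volume.restrict Ω) 2 (τ r) w.2‖ ^ 2)) := by
        have := pi_pos.ne'
        field_simp
    _ ≤ Metric.diam (τ r) ^ 2 / (ε * μ₁ * π ^ 2) * D * (ε * N) := by gcongr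

/-- The data oscillation tested with `w`, absorbed into `w` itself. -/
theorem IsConvexPartition.neg_two_mul_inner_le (hτ : IsConvexPartition Ω τ)
    (hΩ : IsOpen Ω) (f : L2 Ω) {G : L2 Ω} (hG : G =ᵐ[volume.restrict Ω] piecewiseProj τ f)
    (w : L2 Ω) {t : ℝ} (ht : 0 < t) :
    -(2 * inner ℝ (f - G) w) ≤
      t * (∑ r, ∫ x in τ r, (f x - localProj (τ r) f x) ^ 2) + t⁻¹ * ‖w‖ ^ 2 := by
  rw [hτ.inner_sub_eq_sum hΩ f hG, ← hτ.sum_norm_restrict_sq hΩ w, Finset.mul_sum,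
    ← Finset.sum_neg_distrib, Finset.mul_sum, Finset.mul_sum, ← Finset.sum_add_distrib]
  refine Finset.sum_le_sum fun r _ => ?_
  rw [← norm_localError_sq (hτ.subset r)]
  exact ReactionDiffusion.neg_two_mul_inner_le _ _ ht

/-! ### Choice of the parameters -/

/-- The outcome of the Young inequality with the parameters `T` and `T θ`: the terms with the error
`X + θ⁻¹ Y` are absorbed into `T E`. -/
theorem sqEnergy_le_of_parameters {E a b X Y T θ : ℝ} (hT : 0 < T)
    (h : 2 * E ≤ T * a + T⁻¹ * X + (T * θ * b + (T * θ)⁻¹ * Y))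
    (hE : X + θ⁻¹ * Y ≤ T * E) : E ≤ T * (a + θ * b) := by
  have h1 := mul_le_mul_of_nonneg_left hE (inv_pos.2 hT).le
  rw [inv_mul_cancel_left₀ hT.ne', mul_add, ← mul_assoc, ← mul_inv] at h1
  linarith

theorem thetaSmall_pos {σ σs : ℝ} (hσs : 0 < σs) : 0 < thetaSmall σ σs := by
  unfold thetaSmall
  split_ifs with h
  · positivity
  · have : 0 < σ := by linarith
    positivity

theorem thetaBig_pos {σ σs : ℝ} (hσ : 0 ≤ σ) (hσs : 0 < σs) : 0 < thetaBig σ σs := by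
  unfold thetaBig
  split_ifs <;> positivity

theorem add_thetaSmall_inv_mul_le {σ σs X Y : ℝ} (hσ : 0 ≤ σ) (hσs : 0 < σs) (hXY : σs * Y ≤ X) :
    X + (thetaSmall σ σs)⁻¹ * Y ≤ thetaBig σ σs * (X + σ * Y) := by
  unfold thetaSmall thetaBig
  split_ifs with h
  · rw [one_div, inv_inv, show 2 / (1 + σ / σs) * (X + σ * Y) = 2 * σs * (X + σ * Y) / (σs + σ) by
      field_simp, le_div_iff₀ (by linarith)]
    nlinarith [mul_nonneg (sub_nonneg.2 h) (sub_nonneg.2 hXY)]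
  · rw [one_div, inv_inv, one_mul]

theorem thetaOne_pos {σ σs ε : ℝ} (hσ : 0 ≤ σ) (hσs : 0 < σs) (hε : 0 < ε) :
    0 < thetaOne σ σs ε := by
  unfold thetaOne
  split_ifs <;> positivity

theorem add_mul_le_thetaOne {σ σs ε X Y : ℝ} (hσ : 0 ≤ σ) (hσs : 0 < σs) (hε : 0 < ε)
    (hY : 0 ≤ Y) (hXY : σs * Y ≤ X) :
    (1 + ε) * X + σs * Y ≤ thetaOne σ σs ε * (X + σ * Y) := by
  unfold thetaOne
  split_ifs with h
  · rw [le_div_iff₀ (by linarith)] at h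
    rw [show (2 + ε) / (1 + σ / σs) * (X + σ * Y) = (2 + ε) * σs * (X + σ * Y) / (σs + σ) by
      field_simp, le_div_iff₀ (by linarith)]
    nlinarith [mul_nonneg (sub_nonneg.2 h) (sub_nonneg.2 hXY)]
  · rw [not_le, div_lt_iff₀ (by linarith)] at h
    nlinarith [mul_le_mul_of_nonneg_right h.le hY]

theorem thetaTwo_pos {σ σs : ℝ} (hσs : 0 < σs) (h : σs ≤ σ) : 0 < thetaTwo σ σs := by
  have : 0 < σ := by linarith
  unfold thetaTwo
  positivity

theorem add_two_mul_le_thetaTwo {σ σs X Y : ℝ} (hσs : 0 < σs) (h : σs ≤ σ) (hXY : σs * Y ≤ X) :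
    X + 2 * σ * Y ≤ thetaTwo σ σs * (X + σ * Y) := by
  have hσ : 0 < σ := by linarith
  unfold thetaTwo
  rw [show (1 + 1 / (1 + (σ / σs)⁻¹)) * (X + σ * Y) =
    (X + σ * Y) + σ * (X + σ * Y) / (σ + σs) by field_simp]
  have : σ * Y ≤ σ * (X + σ * Y) / (σ + σs) := by
    rw [le_div_iff₀ (by linarith)]
    nlinarith [mul_le_mul_of_nonneg_left hXY hσ.le]
  linarith

end ReactionDiffusion

/-! ### The error estimates -/

theorem mainTheorem1 {m : ℕ} (Ω : Set (Space m)) (hΩ : IsOpen Ω)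
    (A : Space m → Matrix (Fin m) (Fin m) ℝ) (μ₁ μ₂ : ℝ) (hA : IsCoefficient Ω A μ₁ μ₂)
    (σ : ℝ) (hσ : 0 ≤ σ) (f : L2 Ω) (ψ : L2 Ω × L2Vec Ω) (hψ : IsH1 Ω ψ)
    (u : L2 Ω × L2Vec Ω) (hu : IsWeakSolution Ω A σ f ψ u) (σs : ℝ) (hσs : 0 < σs) :
    -- arbitrary approximations and arbitrary test fluxes
    (∀ v : L2 Ω × L2Vec Ω, IsH1 Ω v → v - ψ ∈ H10 Ω →
      σs * ‖(u - v).1‖ ^ 2 ≤ sqNormA Ω A (u - v) →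
      ∀ z : L2Vec Ω × L2 Ω, IsHdiv Ω z →
        sqEnergy Ω A σ (v - u) ≤ thetaBig σ σs * majorant Ω A σ σs f v z ∧
        ∀ (R : ℕ) (τ : Fin R → Set (Space m)), IsConvexPartition Ω τ →
          (σ ≤ σs → ∀ ε : ℝ, 0 < ε →
            sqEnergy Ω A σ (v - u) ≤ thetaOne σ σs ε *
              (majorant Ω A σ σs (piecewiseProj τ f) v z +
                ∑ r, Metric.diam (τ r) ^ 2 / (ε * μ₁ * Real.pi ^ 2) *
                  ∫ x in τ r, (f x - localProj (τ r) f x) ^ 2)) ∧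
          (σs ≤ σ →
            sqEnergy Ω A σ (v - u) ≤ thetaTwo σ σs *
              (majorant Ω A σ σs (piecewiseProj τ f) v z +
                ∑ r, 1 / σ * ∫ x in τ r, (f x - localProj (τ r) f x) ^ 2))) ∧
    -- Galerkin approximations of the homogeneous problem, with the flux `-A∇u_G`
    (u ∈ H10 Ω →
      ∀ V : Submodule ℝ (L2 Ω × L2Vec Ω), V ≤ H10 Ω →
      ∀ _ : (toL2 V).HasOrthogonalProjection,
      ∀ uG : L2 Ω × L2Vec Ω, IsGalerkin Ω A σ f V uG →
      ∀ zG : L2Vec Ω × L2 Ω, IsHdiv Ω zG →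
        (∀ᵐ x ∂volume.restrict Ω, (zG.1 x).ofLp = -(A x *ᵥ (uG.2 x).ofLp)) →
        σs * ‖u.1 - (toL2 V).starProjection u.1‖ ^ 2 ≤ sqNormA Ω A (u - uG) →
        sqEnergy Ω A σ (uG - u) ≤
          thetaBig σ σs * (thetaSmall σ σs * ‖f - σ • uG.1 - zG.2‖ ^ 2)) := by
  refine ⟨fun v hv hvψ hσv z hz => ?_, fun hu0 V hV _ uG huG zG hzG hflux hσG => ?_⟩
  · have he : v - u ∈ H10 Ω := by
      have := (H10 Ω).sub_mem hvψ hu.2.1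
      rwa [sub_sub_sub_cancel_right] at this
    have hXY : σs * ‖(v - u).1‖ ^ 2 ≤ sqNormA Ω A (v - u) := by
      rwa [sqNormA_sub_comm Ω A v u, Prod.fst_sub, norm_sub_rev, ← Prod.fst_sub]
    refine ⟨?_, fun R τ hτ => ?_⟩
    · have hT := thetaBig_pos hσ hσs
      have hθ := thetaSmall_pos (σ := σ) hσs
      rw [majorant_eq σ σs (Filter.EventuallyEq.refl _ (f : Space m → ℝ)) v z]
      have h := two_mul_sqEnergy_le hΩ hA hu he hz f hT (mul_pos hT hθ)
      rw [sub_self, inner_zero_left, mul_zero, sub_zero] at h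
      exact sqEnergy_le_of_parameters hT h (add_thetaSmall_inv_mul_le hσ hσs hXY)
    · set G : L2 Ω := (memLp_piecewiseProj hτ f).toLp with hGdef
      have hG : G =ᵐ[volume.restrict Ω] piecewiseProj τ f := MemLp.coeFn_toLp _
      rw [majorant_eq σ σs hG v z]
      refine ⟨fun hle ε hε => ?_, fun hle => ?_⟩
      · have hT := thetaOne_pos hσ hσs hε
        have hθ : thetaSmall σ σs = 1 / σs := if_pos hle
        have h1 := two_mul_sqEnergy_le hΩ hA hu he hz G hT
          (mul_pos hT (one_div_pos.2 hσs))
        have h2 := hτ.neg_two_mul_inner_le_gradient hΩ hA f hG he hT hε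
        have h3 := add_mul_le_thetaOne hσ hσs hε (sq_nonneg ‖(v - u).1‖) hXY
        rw [hθ, add_right_comm]
        refine sqEnergy_le_of_parameters (X := (1 + ε) * sqNormA Ω A (v - u))
          (Y := ‖(v - u).1‖ ^ 2) hT (by linarith) ?_
        rwa [one_div, inv_inv]
      · have hT := thetaTwo_pos hσs hle
        have hσ0 : 0 < σ := hσs.trans_le hle
        have hθ : thetaSmall σ σs = 1 / σ := by
          unfold thetaSmall
          split_ifs with h
          · rw [le_antisymm h hle]
          · rfl
        have ht := mul_pos hT (one_div_pos.2 hσ0)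
        have h1 := two_mul_sqEnergy_le hΩ hA hu he hz G hT ht
        have h2 := hτ.neg_two_mul_inner_le hΩ f hG (v - u).1 ht
        have h3 := add_two_mul_le_thetaTwo hσs hle hXY
        rw [hθ, add_right_comm, ← Finset.mul_sum]
        refine sqEnergy_le_of_parameters (X := sqNormA Ω A (v - u))
          (Y := 2 * ‖(v - u).1‖ ^ 2) hT (by linarith) ?_
        rw [one_div, inv_inv]
        refine le_trans (le_of_eq ?_) h3
        ring
  · have hT := thetaBig_pos hσ hσs
    have hθ := thetaSmall_pos (σ := σ) hσs
    have hQ := (toL2 V).starProjection_apply_mem u.1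
    obtain ⟨w, hwV, hw⟩ := hQ
    have hwu : w - u ∈ H10 Ω := (H10 Ω).sub_mem (hV hwV) hu0
    -- Galerkin orthogonality replaces the error `u_G - u` by `w - u`, where `w` lifts `Q u`
    have hE : sqEnergy Ω A σ (uG - u) = form Ω A σ uG (w - u) - inner ℝ f (w - u).1 := by
      have h1 : form Ω A σ (uG - u) (w - u) = form Ω A σ uG (w - u) - inner ℝ f (w - u).1 := by
        rw [form_sub_left hΩ hA, hu.2.2 _ hwu, integral_mul_eq_inner]
      have h2 : form Ω A σ (uG - u) (uG - w) = 0 := by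
        have hm : uG - w ∈ V := V.sub_mem huG.1 hwV
        rw [form_sub_left hΩ hA, hu.2.2 _ (hV hm), huG.2 _ hm, sub_self]
      have h3 := form_sub_right hΩ hA σ (uG - u) (uG - u) (w - u)
      rw [sub_sub_sub_cancel_right, h2] at h3
      rw [← h1, ← form_self]
      linarith
    have hq : ‖(w - u).1‖ = ‖u.1 - (toL2 V).starProjection u.1‖ := by
      rw [← hw, Prod.fst_sub, norm_sub_rev]
      rfl
    have hq2 : ‖(w - u).1‖ ≤ ‖(uG - u).1‖ := by
      rw [hq, Submodule.starProjection_minimal, Prod.fst_sub, norm_sub_rev uG.1]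
      exact ciInf_le ⟨0, by rintro _ ⟨x, rfl⟩; exact norm_nonneg _⟩
        (⟨uG.1, uG, huG.1, rfl⟩ : toL2 V)
    have hq0 : ∫ x in Ω, (A x *ᵥ (uG.2 x).ofLp + (zG.1 x).ofLp) ⬝ᵥ ((w - u).2 x).ofLp = 0 := by
      refine integral_eq_zero_of_ae ?_
      filter_upwards [hflux] with x hx
      rw [hx, add_neg_cancel, zero_dotProduct]
      rfl
    have h1 := form_sub_inner_eq hΩ hA σ f f uG hwu hzG
    rw [hq0, ← hE, sub_self, inner_zero_left] at h1
    have h2 := neg_two_mul_inner_le (f - σ • uG.1 - zG.2) (w - u).1 (mul_pos hT hθ)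
    have hXq : σs * ‖(w - u).1‖ ^ 2 ≤ sqNormA Ω A (uG - u) := by
      rwa [hq, ← sqNormA_sub_comm Ω A u uG]
    have h3 := add_thetaSmall_inv_mul_le hσ hσs hXq
    have hEq : sqNormA Ω A (uG - u) + σ * ‖(w - u).1‖ ^ 2 ≤ sqEnergy Ω A σ (uG - u) := by
      unfold sqEnergy
      gcongr
    have hA0 := sqNormA_nonneg hΩ hA (uG - u)
    have := sqEnergy_le_of_parameters (E := sqEnergy Ω A σ (uG - u)) (a := 0)
      (b := ‖f - σ • uG.1 - zG.2‖ ^ 2) (X := sqNormA Ω A (uG - u)) (Y := ‖(w - u).1‖ ^ 2)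
      (θ := thetaSmall σ σs) hT
      (by
        have := mul_nonneg (inv_pos.2 hT).le hA0
        linarith)
      (h3.trans (by gcongr))
    rwa [zero_add] at this
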